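/- Throughout, $q$ is a complex number with $|q|<1$. Let $$E_2(q)=1-24\sum_{n\ge1}\sigma_1(n)q^n,\qquad \theta_2(q)=\sum_{m\in\mathbb Z+\frac12}q^{m^2},\qquad \theta_3(q)=\sum_{m\in\mathbb Z}q^{m^2},$$ where $\sigma_1(n)=\sum_{d\mid n}d$ and $q^{1/4}$ in $\theta_2$ is the principal branch (only powers of $\theta_2^4$ are used, and these do not depend on the branch). For integers $r,s\ge0$ put $$\Theta_{r,s}(q)=\theta_2^{4r}(q)\,\theta_3^{4s}(q)+\theta_2^{4s}(q)\,\theta_3^{4r}(q)$$ (so $\Theta_{0,0}=2$). Let $c_c(\alpha,\beta,\gamma)$, for integers $\alpha,\beta,\gamma$, be the rational numbers determined by $c_c(\alpha,\beta,\gamma)=0$ if any argument is negative, $c_c(0,0,0)=1$, and, for all other $\alpha,\beta,\gamma\ge0$, $$\begin{aligned}c_c(\alpha,\beta,\gamma)&=\tfrac{2\alpha+4\beta+4\gamma-1}{24}\,c_c(\alpha-1,\beta,\gamma)+\tfrac{20\gamma-4\beta+3}{24}\,c_c(\alpha,\beta-1,\gamma)+\tfrac{20\beta-4\gamma+3}{24}\,c_c(\alpha,\beta,\gamma-1)\\&\quad-\tfrac{7(\alpha+1)}{6}\,c_c(\alpha+1,\beta-1,\gamma-1)-\tfrac{\alpha+1}{12}\,c_c(\alpha+1,\beta-2,\gamma)-\tfrac{\alpha+1}{12}\,c_c(\alpha+1,\beta,\gamma-2).\end{aligned}$$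 Let $\mathbf e_0=1$ and let $\mathbf e_j(x_1,\dots,x_r)=\sum_{1\le i_1<\cdots<i_j\le r}x_{i_1}\cdots x_{i_j}$ be the elementary symmetric functions. **Theorem.** Let $t$ be a positive integer. Then MacMahon's series $$\mathcal C_{2t}(q)=\sum_{0<s_1<s_2<\cdots<s_t}\frac{q^{2s_1+2s_2+\cdots+2s_t-t}}{(1-q^{2s_1-1})^2(1-q^{2s_2-1})^2\cdots(1-q^{2s_t-1})^2}$$ (sum over integers $s_i$) converges absolutely for $|q|<1$, and $$\mathcal C_{2t}(q)=\sum_{k=1}^t(-1)^k\,\frac{\mathbf e_{t-k}(0^2,1^2,\dots,(t-1)^2)}{(2t)!}\cdot\frac12\sum_{\substack{\alpha,\beta,\gamma\ge0\\ \alpha+\beta+\gamma=k}}c_c(\alpha,\beta,\gamma)\,E_2(q)^{\alpha}\,\Theta_{\beta,\gamma}(q).$$ -/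

import Mathlib

namespace MacMahonC

noncomputable section

/-- The summand of MacMahon's odd-part series attached to `s 0 < s 1 < ⋯ < s (t-1)`
(positive integers): the product of `q^(2 s_i - 1) / (1 - q^(2 s_i - 1))^2`.
The numerators multiply to `q^(2 s_0 + ⋯ + 2 s_(t-1) - t)`. -/
def term (t : ℕ) (q : ℂ) (s : Fin t ↪o ℕ+) : ℂ :=
  ∏ i, q ^ (2 * (s i : ℕ) - 1) / (1 - q ^ (2 * (s i : ℕ) - 1)) ^ 2

/-- MacMahon's series `𝒞_{2t}(q)`, the sum over all `0 < s₁ < ⋯ < s_t`. -/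
def C (t : ℕ) (q : ℂ) : ℂ := ∑' s : Fin t ↪o ℕ+, term t q s

/-- The Eisenstein series `E_{2k}(q) = 1 - (4k / B_{2k}) ∑_{n ≥ 1} σ_{2k-1}(n) q^n`. -/
def eisenstein (k : ℕ) (q : ℂ) : ℂ :=
  1 - (4 * k / (bernoulli (2 * k) : ℂ)) *
    ∑' n : ℕ+, (ArithmeticFunction.sigma (2 * k - 1) (n : ℕ) : ℂ) * q ^ (n : ℕ)

/-- `θ₂(q) = ∑_{m ∈ ℤ + 1/2} q^(m²)`, with the principal branch of `q^(1/4)`.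
Only powers of `θ₂⁴` occur below, and those do not depend on the branch. -/
def theta2 (q : ℂ) : ℂ := ∑' m : ℤ, q ^ (((m : ℂ) + 1 / 2) ^ 2)

/-- `θ₃(q) = ∑_{m ∈ ℤ} q^(m²)`. -/
def theta3 (q : ℂ) : ℂ := ∑' m : ℤ, q ^ (m ^ 2 : ℤ)

/-- `Θ_{r,s}(q) = θ₂^(4r) θ₃^(4s) + θ₂^(4s) θ₃^(4r)`; in particular `Θ_{0,0} = 2`. -/
def Theta (r s : ℕ) (q : ℂ) : ℂ :=
  theta2 q ^ (4 * r) * theta3 q ^ (4 * s) + theta2 q ^ (4 * s) * theta3 q ^ (4 * r)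

/-- The recursively defined coefficients `c_c(α, β, γ)`: zero if an argument is negative,
`c_c(0, 0, 0) = 1`, and given by the recursion at every other triple of nonnegative integers. -/
def cc (α β γ : ℤ) : ℚ :=
  if α < 0 ∨ β < 0 ∨ γ < 0 then 0
  else if α = 0 ∧ β = 0 ∧ γ = 0 then 1
  else
    (2 * α + 4 * β + 4 * γ - 1) / 24 * cc (α - 1) β γ
    + (20 * γ - 4 * β + 3) / 24 * cc α (β - 1) γ
    + (20 * β - 4 * γ + 3) / 24 * cc α β (γ - 1)
    - 7 * (α + 1) / 6 * cc (α + 1) (β - 1) (γ - 1)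
    - (α + 1) / 12 * cc (α + 1) (β - 2) γ
    - (α + 1) / 12 * cc (α + 1) β (γ - 2)
termination_by (α + β + γ).toNat
decreasing_by all_goals omega

/-- `e_j(0², 1², …, (t-1)²)`, the elementary symmetric function of degree `j`
(with `e_0 = 1`). -/
def esymmSquares (t j : ℕ) : ℕ := ((Multiset.range t).map (fun i => i ^ 2)).esymm j

/-- `∑ c_c(α, β, γ) E₂(q)^α Θ_{β,γ}(q)` over all `α, β, γ ≥ 0` with `α + β + γ = k`. -/
def expansion (k : ℕ) (q : ℂ) : ℂ :=
  ∑ x ∈ Finset.HasAntidiagonal.antidiagonal k, ∑ y ∈ Finset.HasAntidiagonal.antidiagonal x.2,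
    (cc x.1 y.1 y.2 : ℂ) * eisenstein 1 q ^ x.1 * Theta y.1 y.2 q

end

end MacMahonC

namespace MacMahonC

open Filter Topology Finset

noncomputable section

/-! Write `D = q d/dq`. The proof computes `C t q * theta4 q` as a combination of the derivatives
`D^k θ₄`, and shows that each of these is `θ₄` times a polynomial in `E₂`, `a = θ₂⁴`, `b = θ₃⁴` with
coefficients `cc`.

Combinatorial half. With `w = q^(2s-1)` and `z + z⁻¹ = 2 - X`, one has `(1 - zw)(1 - z⁻¹w) = (1 -
w)²(1 + X w/(1 - w)²)`. The product over `s` is therefore, up to a factor free of `X`, the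
generating function of MacMahon's series, while the Jacobi triple product expands it as a multiple
of `∑ (-1)ⁿ q^(n²) zⁿ`. Symmetrizing in `n` replaces `zⁿ` by `Tₙ(1 - X/2)`, whose `X^t` coefficient
is `(-1)^t/(2t)! ∏_{j<t} (n² - j²)`. Dividing by the case `X = 0` gives `C_mul_theta4_eq_tsum`;
expanding in powers of `n²` produces the elementary symmetric functions and the moments `D^k θ₄`
(`C_mul_theta4`). The argument is run with finitely many factors (`partialEsymm_oddTerm`), followed
by a limit.

Differential half. `E₂`, `a`, `b` satisfy Ramanujan-type equations, and `D θ₄ / θ₄ = (E₂ - a -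
b)/24`. Hence `D^k θ₄ = θ₄ F_k(E₂, a, b)` with `F_{k+1} = D F_k + (E₂ - a - b)/24 · F_k`, and
comparing coefficients is exactly the recursion for `cc` (`theta4Moment_eq`). Its symmetry in `β, γ`
accounts for `Θ_{β,γ}` and the factor `1/2`.

The differential equations need no modular forms: the duplication formulas relate values at `q` and
`q²`, and since `q^(2^k) → 0`, a function with a suitable behaviour under `q ↦ q²` is determined by
its germ at `0`. -/

/-- The operator `q d/dq`. -/
def qD (f : ℂ → ℂ) (q : ℂ) : ℂ := q * deriv f q

/-! ### Power series on the unit disc and termwise differentiation. -/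

/-- The family of monomials `c n * q ^ e n` is absolutely summable on the unit disc. -/
def DiscSummable {ι : Type*} (c : ι → ℂ) (e : ι → ℕ) : Prop :=
  ∀ r : ℝ, 0 ≤ r → r < 1 → Summable fun n => ‖c n‖ * r ^ e n

section DiscSummable
variable {ι : Type*} {c : ι → ℂ} {e : ι → ℕ}

theorem DiscSummable.summable_norm (h : DiscSummable c e) {q : ℂ} (hq : ‖q‖ < 1) :
    Summable fun n => ‖c n * q ^ e n‖ := by
  simpa [norm_mul, norm_pow] using h ‖q‖ (norm_nonneg q) hq

theorem DiscSummable.summable (h : DiscSummable c e) {q : ℂ} (hq : ‖q‖ < 1) :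
    Summable fun n => c n * q ^ e n :=
  (h.summable_norm hq).of_norm

theorem exists_natCast_mul_pow_le {r s : ℝ} (hr : 0 ≤ r) (hs : r < s) :
    ∃ K : ℝ, ∀ m : ℕ, (m : ℝ) * r ^ m ≤ K * s ^ m := by
  have hs0 : 0 < s := hr.trans_lt hs
  have h1 : |r / s| < 1 := by
    rw [abs_of_nonneg (by positivity), div_lt_one hs0]; exact hs
  obtain ⟨K, hK⟩ := (tendsto_self_mul_const_pow_of_abs_lt_one h1).bddAbove_range
  refine ⟨K, fun m => ?_⟩
  have := hK ⟨m, rfl⟩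
  simp only [div_pow] at this
  rw [← mul_div_assoc, div_le_iff₀ (by positivity)] at this
  exact this

/-- A factor `m` is absorbed by passing from radius `r` to a larger `s < 1`, so summability survives
termwise application of `q d/dq`. -/
theorem DiscSummable.natCast_mul (h : DiscSummable c e) :
    DiscSummable (fun n => (e n : ℂ) * c n) e := by
  intro r hr hr1
  obtain ⟨s, hs, hs1⟩ := exists_between hr1
  obtain ⟨K, hK⟩ := exists_natCast_mul_pow_le hr hs
  refine ((h s (hr.trans hs.le) hs1).mul_left K).of_nonneg_of_le (fun n => by positivity)
    fun n => ?_
  simp only [norm_mul, Complex.norm_natCast]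
  calc (e n : ℝ) * ‖c n‖ * r ^ e n = ‖c n‖ * (e n * r ^ e n) := by ring
    _ ≤ ‖c n‖ * (K * s ^ e n) := mul_le_mul_of_nonneg_left (hK _) (norm_nonneg _)
    _ = _ := by ring

theorem DiscSummable.differentiableOn (h : DiscSummable c e) :
    DifferentiableOn ℂ (fun q => ∑' n, c n * q ^ e n) (Metric.ball 0 1) := by
  intro q hq
  have hq' : ‖q‖ < 1 := by simpa using hq
  obtain ⟨s, hs, hs1⟩ := exists_between hq'
  have hs0 : 0 ≤ s := (norm_nonneg q).trans hs.le
  have := Complex.differentiableOn_tsum_of_summable_norm (h s hs0 hs1)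
    (U := Metric.ball (0 : ℂ) s) (F := fun n (q : ℂ) => c n * q ^ e n)
    (fun n => by fun_prop) Metric.isOpen_ball (fun n w hw => by
      have : ‖w‖ ≤ s := by simpa using (mem_ball_zero_iff.1 hw).le
      rw [norm_mul, norm_pow]; gcongr)
  exact (this.differentiableAt (Metric.isOpen_ball.mem_nhds (by simpa using hs))).differentiableWithinAt

theorem DiscSummable.qD_eq (h : DiscSummable c e) {q : ℂ} (hq : ‖q‖ < 1) :
    qD (fun q => ∑' n, c n * q ^ e n) q = ∑' n, (e n : ℂ) * c n * q ^ e n := by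
  obtain ⟨s, hs, hs1⟩ := exists_between hq
  have hs0 : 0 ≤ s := (norm_nonneg q).trans hs.le
  have := Complex.hasSum_deriv_of_summable_norm (h s hs0 hs1)
    (U := Metric.ball (0 : ℂ) s) (F := fun n (q : ℂ) => c n * q ^ e n)
    (fun n => by fun_prop) Metric.isOpen_ball (fun n w hw => by
      have : ‖w‖ ≤ s := by simpa using (mem_ball_zero_iff.1 hw).le
      rw [norm_mul, norm_pow]; gcongr) (show q ∈ Metric.ball (0 : ℂ) s by simpa using hs)
  rw [qD, ← this.tsum_eq, ← tsum_mul_left]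
  refine tsum_congr fun n => ?_
  rw [deriv_const_mul _ (by fun_prop), deriv_pow_field]
  rcases Nat.eq_zero_or_pos (e n) with h0 | h0
  · simp [h0]
  · obtain ⟨k, hk⟩ := Nat.exists_eq_succ_of_ne_zero h0.ne'
    rw [hk]; simp only [Nat.succ_eq_add_one, Nat.add_sub_cancel]; ring

end DiscSummable

/-! ### Theta series with natural exponents. -/

/-- `θ₄` with the factor `n ^ (2 * k)` inserted in the summand. -/
def theta4Moment (k : ℕ) (q : ℂ) : ℂ :=
  ∑' n : ℤ, ((-1) ^ n.natAbs * (n : ℂ) ^ (2 * k)) * q ^ (n.natAbs ^ 2)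

/-- `θ₄(q) = ∑ (-1)ⁿ q^(n²)`. -/
def theta4 (q : ℂ) : ℂ := ∑' n : ℤ, (-1) ^ n.natAbs * q ^ (n.natAbs ^ 2)

/-- `θ₃(q)` with natural exponents. -/
def theta3' (q : ℂ) : ℂ := ∑' n : ℤ, 1 * q ^ (n.natAbs ^ 2)

/-- `ψ(q) = ∑ q^(n² + n) = q^(-1/4) θ₂(q)`. -/
def psi (q : ℂ) : ℂ := ∑' n : ℤ, 1 * q ^ (n * (n + 1)).natAbs

theorem summable_pow_natAbs {r : ℝ} (h0 : 0 ≤ r) (h1 : r < 1) :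
    Summable fun n : ℤ => r ^ n.natAbs := by
  have := summable_geometric_of_lt_one h0 h1
  refine Summable.of_nat_of_neg (by simpa using this) (by simpa using this)

theorem discSummable_of_sq {c : ℤ → ℂ} (hc : ∀ n, ‖c n‖ ≤ 1) :
    DiscSummable c fun n => n.natAbs ^ 2 := by
  intro r h0 h1
  refine (summable_pow_natAbs h0 h1).of_nonneg_of_le (fun n => by positivity) fun n => ?_
  calc ‖c n‖ * r ^ (n.natAbs ^ 2) ≤ 1 * r ^ n.natAbs :=
        mul_le_mul (hc n) (pow_le_pow_of_le_one h0 h1.le (Nat.le_self_pow two_ne_zero _))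
          (by positivity) zero_le_one
    _ = _ := one_mul _

theorem discSummable_psi : DiscSummable (fun _ : ℤ => 1) fun n => (n * (n + 1)).natAbs := by
  intro r h0 h1
  have hs : Summable fun n : ℕ => r ^ (n * (n + 1)) :=
    (summable_geometric_of_lt_one h0 h1).of_nonneg_of_le (fun n => by positivity) fun n =>
      pow_le_pow_of_le_one h0 h1.le (by nlinarith)
  simp only [norm_one, one_mul]
  refine Summable.of_nat_of_neg_add_one ?_ ?_
  · convert hs using 3 with n
    rw [show (n : ℤ) * (n + 1) = ((n * (n + 1) : ℕ) : ℤ) by push_cast; ring, Int.natAbs_natCast]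
  · convert hs using 3 with n
    rw [show (-((n : ℤ) + 1)) * (-((n : ℤ) + 1) + 1) = ((n * (n + 1) : ℕ) : ℤ) by push_cast; ring,
      Int.natAbs_natCast]

theorem discSummable_theta4 : DiscSummable (fun n : ℤ => (-1) ^ n.natAbs) fun n => n.natAbs ^ 2 :=
  discSummable_of_sq fun n => by simp

theorem discSummable_theta3 : DiscSummable (fun _ : ℤ => 1) fun n => n.natAbs ^ 2 :=
  discSummable_of_sq fun n => by simp

theorem natCast_natAbs_sq (n : ℤ) : ((n.natAbs ^ 2 : ℕ) : ℂ) = (n : ℂ) ^ 2 := by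
  have := congrArg (Int.cast : ℤ → ℂ) (Int.natAbs_sq n)
  push_cast at this ⊢
  simpa using this

theorem discSummable_theta4Moment (k : ℕ) :
    DiscSummable (fun n : ℤ => (-1) ^ n.natAbs * (n : ℂ) ^ (2 * k)) fun n => n.natAbs ^ 2 := by
  induction k with
  | zero => simpa using discSummable_theta4
  | succ k ih =>
    convert ih.natCast_mul using 2 with n
    rw [natCast_natAbs_sq]; ring

theorem qD_theta4Moment (k : ℕ) {q : ℂ} (hq : ‖q‖ < 1) :
    qD (theta4Moment k) q = theta4Moment (k + 1) q := by
  refine ((discSummable_theta4Moment k).qD_eq hq).trans (tsum_congr fun n => ?_)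
  rw [natCast_natAbs_sq]; ring

theorem theta4Moment_zero : theta4Moment 0 = theta4 := by
  ext q; simp [theta4Moment, theta4]

theorem differentiableOn_theta4 : DifferentiableOn ℂ theta4 (Metric.ball 0 1) :=
  discSummable_theta4.differentiableOn

theorem differentiableOn_theta3' : DifferentiableOn ℂ theta3' (Metric.ball 0 1) :=
  discSummable_theta3.differentiableOn

theorem differentiableOn_psi : DifferentiableOn ℂ psi (Metric.ball 0 1) :=
  discSummable_psi.differentiableOn

theorem theta4_zero : theta4 0 = 1 := by
  rw [theta4, tsum_eq_single 0 (fun n hn => by simp [hn])]; simp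

theorem theta3'_zero : theta3' 0 = 1 := by
  rw [theta3', tsum_eq_single 0 (fun n hn => by simp [hn])]; simp

theorem psi_zero : psi 0 = 2 := by
  rw [psi, tsum_eq_sum (s := {0, -1}) (fun n hn => ?_)]
  · rw [Finset.sum_pair (by norm_num)]; norm_num
  · simp only [Finset.mem_insert, Finset.mem_singleton, not_or] at hn
    have : n * (n + 1) ≠ 0 := mul_ne_zero hn.1 (by omega)
    simp only [one_mul]
    exact zero_pow (by simpa using ⟨hn.1, by omega⟩)

theorem theta3'_eq_theta4_neg (q : ℂ) : theta3' q = theta4 (-q) := by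
  refine tsum_congr fun n => ?_
  rw [neg_pow q, ← mul_assoc, ← pow_add, Even.neg_one_pow, one_mul]
  rw [sq, Nat.even_add, Nat.even_mul]; tauto

theorem theta3_eq (q : ℂ) : theta3 q = theta3' q := by
  refine tsum_congr fun n => ?_
  rw [one_mul, ← zpow_natCast]; congr 1; push_cast; simp

/-- Since `(n + 1/2)² = 1/4 + n(n + 1)`, the branch factor `q^(1/4)` comes out of the series and its
fourth power is `q`. The rest of the proof can then use the holomorphic `psi`. -/
theorem theta2_pow_four (q : ℂ) : theta2 q ^ 4 = q * psi q ^ 4 := by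
  by_cases h0 : q = 0
  · subst h0
    have : theta2 0 = 0 := by
      rw [theta2]; convert tsum_zero with n
      rw [Complex.zero_cpow]
      refine pow_ne_zero _ fun h => ?_
      have h2 : ((2 * n + 1 : ℤ) : ℂ) = 0 := by push_cast; linear_combination 2 * h
      have h3 : (2 * n + 1 : ℤ) = 0 := by exact_mod_cast h2
      omega
    rw [this]; simp
  · have : theta2 q = q ^ (1 / 4 : ℂ) * psi q := by
      rw [theta2, psi, ← tsum_mul_left]
      refine tsum_congr fun n => ?_
      rw [show ((n : ℂ) + 1 / 2) ^ 2 = 1 / 4 + ((n * (n + 1) : ℤ) : ℂ) by push_cast; ring,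
        Complex.cpow_add _ _ h0, Complex.cpow_intCast, one_mul, ← zpow_natCast,
        Int.natAbs_of_nonneg]
      rcases le_or_gt 0 n with h | h
      · exact mul_nonneg h (by omega)
      · exact mul_nonneg_of_nonpos_of_nonpos h.le (by omega)
    rw [this, mul_pow, ← Complex.cpow_nat_mul]; norm_num

/-! ### Duplication formulas relating theta series at `q` and `q²`. -/

/-- Splitting pairs of integers `(m, n)` by the parity of `m + n`:
either `(i + j, i - j)` or `(i + j + 1, i - j)`. -/
def parityEquiv : (ℤ × ℤ) ⊕ (ℤ × ℤ) ≃ ℤ × ℤ where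
  toFun := Sum.elim (fun p => (p.1 + p.2, p.1 - p.2)) (fun p => (p.1 + p.2 + 1, p.1 - p.2))
  invFun p := if (p.1 + p.2) % 2 = 0 then Sum.inl ((p.1 + p.2) / 2, (p.1 - p.2) / 2)
    else Sum.inr ((p.1 + p.2 - 1) / 2, (p.1 - p.2 - 1) / 2)
  left_inv := by
    rintro (⟨i, j⟩ | ⟨i, j⟩)
    · have h : (i + j + (i - j)) % 2 = 0 := by omega
      simp only [Sum.elim_inl, h, if_true, Sum.inl.injEq, Prod.mk.injEq]
      omega
    · have h : ¬ (i + j + 1 + (i - j)) % 2 = 0 := by omega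
      simp only [Sum.elim_inr, h, if_false, Sum.inr.injEq, Prod.mk.injEq]
      omega
  right_inv := by
    rintro ⟨m, n⟩
    by_cases h : (m + n) % 2 = 0
    · simp only [h, if_true, Sum.elim_inl, Prod.mk.injEq]
      omega
    · simp only [h, if_false, Sum.elim_inr, Prod.mk.injEq]
      omega

theorem tsum_mul_tsum_parity {f g : ℤ → ℂ} (hf : Summable fun n => ‖f n‖)
    (hg : Summable fun n => ‖g n‖) :
    (∑' n, f n) * ∑' n, g n = ∑' p : ℤ × ℤ, f (p.1 + p.2) * g (p.1 - p.2) +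
      ∑' p : ℤ × ℤ, f (p.1 + p.2 + 1) * g (p.1 - p.2) := by
  have hs := (summable_mul_of_summable_norm hf hg)
  rw [tsum_mul_tsum_of_summable_norm hf hg, ← parityEquiv.tsum_eq]
  have hs' := parityEquiv.summable_iff.2 hs
  rw [Summable.tsum_sum]
  · rfl
  · exact hs'.comp_injective Sum.inl_injective
  · exact hs'.comp_injective Sum.inr_injective

theorem tsum_prod_mul {f g : ℤ → ℂ} (hf : Summable fun n => ‖f n‖)
    (hg : Summable fun n => ‖g n‖) :
    ∑' p : ℤ × ℤ, f p.1 * g p.2 = (∑' n, f n) * ∑' n, g n :=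
  (tsum_mul_tsum_of_summable_norm hf hg).symm

theorem natAbs_mul_add_one (n : ℤ) : (((n * (n + 1)).natAbs : ℕ) : ℤ) = n * (n + 1) := by
  rw [Int.natAbs_of_nonneg]
  rcases le_or_gt 0 n with h | h
  · exact mul_nonneg h (by omega)
  · exact mul_nonneg_of_nonpos_of_nonpos h.le (by omega)

variable {q : ℂ}

theorem norm_sq_lt_one (hq : ‖q‖ < 1) : ‖q ^ 2‖ < 1 := by
  rw [norm_pow]; exact pow_lt_one₀ (norm_nonneg q) hq two_ne_zero

/-- The involution `n ↦ -1 - n` preserves `n(n + 1)` and reverses the sign. -/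
theorem tsum_alternating_psi : ∑' n : ℤ, (-1) ^ n.natAbs * q ^ (n * (n + 1)).natAbs = 0 := by
  have h := (Equiv.subLeft (-1 : ℤ)).tsum_eq
    (fun n : ℤ => (-1 : ℂ) ^ n.natAbs * q ^ (n * (n + 1)).natAbs)
  have h2 : ∀ n : ℤ, (-1 : ℂ) ^ ((Equiv.subLeft (-1 : ℤ)) n).natAbs *
      q ^ ((Equiv.subLeft (-1 : ℤ)) n * ((Equiv.subLeft (-1 : ℤ)) n + 1)).natAbs =
      -((-1 : ℂ) ^ n.natAbs * q ^ (n * (n + 1)).natAbs) := by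
    intro n
    simp only [Equiv.subLeft_apply]
    rw [show (-1 - n) * (-1 - n + 1) = n * (n + 1) by ring, ← neg_mul]
    congr 1
    rcases Int.even_or_odd n with hn | hn
    · rw [(Int.natAbs_even.2 hn).neg_one_pow, Odd.neg_one_pow]
      rw [Int.natAbs_odd]; exact (by decide : Odd (-1 : ℤ)).sub_even hn
    · rw [(Int.natAbs_odd.2 hn).neg_one_pow, Even.neg_one_pow]; · simp
      rw [Int.natAbs_even]; exact (by decide : Odd (-1 : ℤ)).sub_odd hn
  simp only [h2, tsum_neg] at h
  exact self_eq_neg.1 h.symm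

/-- This is `θ₃(q)² = θ₃(q²)² + θ₂(q²)²`: `(i+j)² + (i-j)² = 2i² + 2j²` and `(i+j+1)² + (i-j)² = 1 +
2i(i+1) + 2j(j+1)`. -/
theorem theta3'_mul_self (hq : ‖q‖ < 1) :
    theta3' q ^ 2 = theta3' (q ^ 2) ^ 2 + q * psi (q ^ 2) ^ 2 := by
  have hs := discSummable_theta3.summable_norm hq
  have h3 := discSummable_theta3.summable_norm (norm_sq_lt_one hq)
  have hp := discSummable_psi.summable_norm (norm_sq_lt_one hq)
  rw [sq, sq (theta3' _), sq (psi _)]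
  refine (tsum_mul_tsum_parity hs hs).trans ?_
  congr 1
  · refine Eq.trans (tsum_congr fun p => ?_) (tsum_prod_mul h3 h3)
    simp only [one_mul, ← pow_mul, ← pow_add]
    congr 1
    rw [← Nat.cast_inj (R := ℤ)]
    simp only [Nat.cast_add, Nat.cast_mul, Nat.cast_pow, Int.natAbs_sq, Nat.cast_ofNat]
    ring
  · refine Eq.trans ?_ (congrArg (q * ·) (tsum_prod_mul hp hp))
    rw [← tsum_mul_left]
    refine tsum_congr fun p => ?_
    simp only [one_mul, ← pow_mul, ← pow_add, ← pow_succ']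
    congr 1
    rw [← Nat.cast_inj (R := ℤ)]
    simp only [Nat.cast_add, Nat.cast_mul, Nat.cast_pow, Int.natAbs_sq, natAbs_mul_add_one, Nat.cast_ofNat,
        Nat.cast_one]
    ring

theorem theta4_mul_self (hq : ‖q‖ < 1) :
    theta4 q ^ 2 = theta3' (q ^ 2) ^ 2 - q * psi (q ^ 2) ^ 2 := by
  have := theta3'_mul_self (q := -q) (by simpa using hq)
  rw [theta3'_eq_theta4_neg, neg_neg, neg_sq] at this
  rw [this]; ring

theorem psi_mul_self (hq : ‖q‖ < 1) : psi q ^ 2 = 2 * psi (q ^ 2) * theta3' (q ^ 2) := by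
  have hs := discSummable_psi.summable_norm hq
  have h3 := discSummable_theta3.summable_norm (norm_sq_lt_one hq)
  have hp := discSummable_psi.summable_norm (norm_sq_lt_one hq)
  rw [sq, mul_assoc, two_mul]
  refine (tsum_mul_tsum_parity hs hs).trans ?_
  congr 1
  · refine Eq.trans (tsum_congr fun p => ?_) (tsum_prod_mul hp h3)
    simp only [one_mul, ← pow_mul, ← pow_add]
    congr 1
    rw [← Nat.cast_inj (R := ℤ)]
    simp only [Nat.cast_add, Nat.cast_mul, Nat.cast_pow, Int.natAbs_sq, natAbs_mul_add_one, Nat.cast_ofNat]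
    ring
  · rw [mul_comm]
    refine Eq.trans ?_ (tsum_prod_mul h3 hp)
    -- The exponent here is `2(i+1)² + 2j(j+1)`; shifting `i` by `-1` turns it into `2i² + 2j(j+1)`.
    rw [← ((Equiv.addRight (-1 : ℤ)).prodCongr (Equiv.refl ℤ)).tsum_eq]
    refine tsum_congr fun p => ?_
    simp only [one_mul, ← pow_mul, ← pow_add, Equiv.prodCongr_apply, Prod.map_fst, Prod.map_snd,
      Equiv.coe_addRight, Equiv.refl_apply]
    congr 1
    rw [← Nat.cast_inj (R := ℤ)]
    simp only [Nat.cast_add, Nat.cast_mul, Nat.cast_pow, Int.natAbs_sq, natAbs_mul_add_one, Nat.cast_ofNat]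
    ring

theorem theta3'_mul_theta4 (hq : ‖q‖ < 1) : theta3' q * theta4 q = theta4 (q ^ 2) ^ 2 := by
  have h3 := discSummable_theta3.summable_norm hq
  have h4 := discSummable_theta4.summable_norm hq
  have h4' := discSummable_theta4.summable_norm (norm_sq_lt_one hq)
  have hp := discSummable_psi.summable_norm (norm_sq_lt_one hq)
  have hp' : Summable fun n : ℤ => ‖(-1) ^ n.natAbs * (q ^ 2) ^ (n * (n + 1)).natAbs‖ := by
    simpa using hp
  have hsign : ∀ p : ℤ × ℤ, (-1 : ℂ) ^ (p.1 - p.2).natAbs = (-1) ^ p.1.natAbs * (-1) ^ p.2.natAbs := by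
    intro p
    rw [← pow_add]
    refine neg_one_pow_congr ?_
    rw [Nat.even_add, Int.natAbs_even, Int.natAbs_even, Int.natAbs_even, Int.even_sub]
  rw [sq (theta4 _)]
  refine (tsum_mul_tsum_parity h3 h4).trans ?_
  -- The pairs of odd sum contribute `q` times the square of the vanishing alternating series.
  have h0 : ∑' p : ℤ × ℤ, (1 * q ^ ((p.1 + p.2 + 1).natAbs ^ 2)) *
      ((-1) ^ (p.1 - p.2).natAbs * q ^ ((p.1 - p.2).natAbs ^ 2)) = 0 := by
    refine Eq.trans ?_ (congrArg (q * ·) ((tsum_prod_mul hp' hp').trans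
      (by rw [tsum_alternating_psi, zero_mul]))) |>.trans (mul_zero q)
    rw [← tsum_mul_left]
    refine tsum_congr fun p => ?_
    rw [hsign, one_mul, mul_left_comm, ← pow_add q, mul_mul_mul_comm, ← pow_mul, ← pow_mul,
      ← pow_add q, mul_left_comm, ← pow_succ']
    congr 2
    rw [← Nat.cast_inj (R := ℤ)]
    simp only [Nat.cast_add, Nat.cast_mul, Nat.cast_pow, Int.natAbs_sq, natAbs_mul_add_one, Nat.cast_ofNat,
        Nat.cast_one]
    ring
  rw [h0, add_zero]
  refine Eq.trans (tsum_congr fun p => ?_) (tsum_prod_mul h4' h4')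
  rw [hsign, one_mul, mul_left_comm, ← pow_add q, mul_mul_mul_comm, ← pow_mul, ← pow_mul,
    ← pow_add q]
  congr 2
  rw [← Nat.cast_inj (R := ℤ)]
  simp only [Nat.cast_add, Nat.cast_mul, Nat.cast_pow, Int.natAbs_sq, Nat.cast_ofNat]
  ring

/-! ### Calculus of `q d/dq` at a point. -/

/-- `f` is differentiable at `q` and `q f'(q) = d`. -/
def HasQD (f : ℂ → ℂ) (d q : ℂ) : Prop := ∃ f', HasDerivAt f f' q ∧ q * f' = d

namespace HasQD
variable {f g : ℂ → ℂ} {d d' q : ℂ}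

theorem qD_eq (h : HasQD f d q) : qD f q = d := by
  obtain ⟨f', h, rfl⟩ := h
  rw [qD, h.deriv]

theorem unique (h : HasQD f d q) (h' : HasQD f d' q) : d = d' := h.qD_eq.symm.trans h'.qD_eq

theorem congr_eq (h : HasQD f d q) (e : d = d') : HasQD f d' q := e ▸ h

theorem add (hf : HasQD f d q) (hg : HasQD g d' q) : HasQD (fun q => f q + g q) (d + d') q := by
  obtain ⟨f', hf, rfl⟩ := hf
  obtain ⟨g', hg, rfl⟩ := hg
  exact ⟨_, hf.add hg, by ring⟩

theorem sub (hf : HasQD f d q) (hg : HasQD g d' q) : HasQD (fun q => f q - g q) (d - d') q := by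
  obtain ⟨f', hf, rfl⟩ := hf
  obtain ⟨g', hg, rfl⟩ := hg
  exact ⟨_, hf.sub hg, by ring⟩

theorem mul (hf : HasQD f d q) (hg : HasQD g d' q) :
    HasQD (fun q => f q * g q) (d * g q + f q * d') q := by
  obtain ⟨f', hf, rfl⟩ := hf
  obtain ⟨g', hg, rfl⟩ := hg
  exact ⟨_, hf.mul hg, by ring⟩

theorem const_mul (c : ℂ) (hf : HasQD f d q) : HasQD (fun q => c * f q) (c * d) q := by
  obtain ⟨f', hf, rfl⟩ := hf
  exact ⟨_, hf.const_mul c, by ring⟩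

theorem pow (hf : HasQD f d q) (n : ℕ) : HasQD (fun q => f q ^ n) (n * f q ^ (n - 1) * d) q := by
  obtain ⟨f', hf, rfl⟩ := hf
  exact ⟨_, hf.pow n, by ring⟩

theorem sum {ι : Type*} {s : Finset ι} {F : ι → ℂ → ℂ} {D : ι → ℂ}
    (h : ∀ i ∈ s, HasQD (F i) (D i) q) : HasQD (fun q => ∑ i ∈ s, F i q) (∑ i ∈ s, D i) q := by
  classical
  induction s using Finset.induction_on with
  | empty => exact ⟨0, by simpa using hasDerivAt_const q (0 : ℂ), by simp⟩
  | insert i s hi ih =>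
    simp only [Finset.sum_insert hi]
    exact (h i (Finset.mem_insert_self i s)).add
      (ih fun j hj => h j (Finset.mem_insert_of_mem hj))

theorem id (q : ℂ) : HasQD (fun q => q) q q := ⟨1, hasDerivAt_id q, mul_one q⟩

theorem comp_sq (hf : HasQD f d (q ^ 2)) : HasQD (fun q => f (q ^ 2)) (2 * d) q := by
  obtain ⟨f', hf, rfl⟩ := hf
  have := hf.comp q (hasDerivAt_pow 2 q)
  exact ⟨_, this, by push_cast; ring⟩

theorem congr_disc (hf : HasQD f d q) (hq : ‖q‖ < 1) (h : ∀ w : ℂ, ‖w‖ < 1 → g w = f w) :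
    HasQD g d q := by
  obtain ⟨f', hf, rfl⟩ := hf
  refine ⟨f', hf.congr_of_eventuallyEq ?_, rfl⟩
  filter_upwards [Metric.isOpen_ball.mem_nhds (mem_ball_zero_iff.2 hq)] with w hw
  exact h w (mem_ball_zero_iff.1 hw)

theorem of_differentiableOn (hf : DifferentiableOn ℂ f (Metric.ball 0 1)) (hq : ‖q‖ < 1) :
    HasQD f (qD f q) q :=
  ⟨_, (hf.differentiableAt (Metric.isOpen_ball.mem_nhds (mem_ball_zero_iff.2 hq))).hasDerivAt, rfl⟩

end HasQD

/-! ### Rigidity under `q ↦ q²`, and nonvanishing of the theta functions. -/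

theorem norm_pow_two_pow_lt_one (hq : ‖q‖ < 1) (k : ℕ) : ‖q ^ 2 ^ k‖ < 1 := by
  rw [norm_pow]; exact pow_lt_one₀ (norm_nonneg q) hq (by positivity)

theorem tendsto_pow_two_pow (hq : ‖q‖ < 1) : Tendsto (fun k : ℕ => q ^ 2 ^ k) atTop (𝓝 0) :=
  (tendsto_pow_atTop_nhds_zero_of_norm_lt_one hq).comp
    (tendsto_pow_atTop_atTop_of_one_lt one_lt_two)

theorem eq_apply_zero_of_sq_invariant {f : ℂ → ℂ} (hf : ContinuousAt f 0)
    (h : ∀ w : ℂ, ‖w‖ < 1 → f w = f (w ^ 2)) (hq : ‖q‖ < 1) : f q = f 0 := by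
  have hk : ∀ k : ℕ, f (q ^ 2 ^ k) = f q := by
    intro k
    induction k with
    | zero => simp
    | succ k ih => rw [← ih, h _ (norm_pow_two_pow_lt_one hq k), ← pow_mul, pow_succ]
  have := hf.tendsto.comp (tendsto_pow_two_pow hq)
  simp only [Function.comp_def, hk] at this
  exact tendsto_nhds_unique tendsto_const_nhds this

/-- A zero at `q` would propagate to all `q^(2^k)`, which tend to `0`, contradicting `f 0 ≠ 0`. This
replaces product formulas in proving that the theta functions have no zeros in the disc. -/
theorem ne_zero_of_sq_zero {f : ℂ → ℂ} (hf : ContinuousAt f 0) (h0 : f 0 ≠ 0)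
    (h : ∀ w : ℂ, ‖w‖ < 1 → f w = 0 → f (w ^ 2) = 0) (hq : ‖q‖ < 1) : f q ≠ 0 := by
  intro hz
  have hk : ∀ k : ℕ, f (q ^ 2 ^ k) = 0 := by
    intro k
    induction k with
    | zero => simpa using hz
    | succ k ih => rw [pow_succ, pow_mul]; exact h _ (norm_pow_two_pow_lt_one hq k) ih
  have := hf.tendsto.comp (tendsto_pow_two_pow hq)
  simp only [Function.comp_def, hk] at this
  exact h0 (tendsto_nhds_unique this tendsto_const_nhds)

/-- A function with `f(q) = 4 f(q²)` on the disc that vanishes to first order at `0` is zero. -/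
theorem eq_zero_of_eq_four_mul_sq {f : ℂ → ℂ} (hf : DifferentiableAt ℂ f 0)
    (h : ∀ w : ℂ, ‖w‖ < 1 → f w = 4 * f (w ^ 2)) (hq : ‖q‖ < 1) : f q = 0 := by
  have h0 : f 0 = 0 := by
    have := h 0 (by simp)
    rw [zero_pow two_ne_zero] at this
    linear_combination -(1 / 3 : ℂ) * this
  have hk : ∀ k : ℕ, f q = 4 ^ k * f (q ^ 2 ^ k) := by
    intro k
    induction k with
    | zero => simp
    | succ k ih =>
      rw [ih, h _ (norm_pow_two_pow_lt_one hq k), ← pow_mul, ← pow_succ 2, pow_succ (4 : ℂ)]; ring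
  -- Near `0` one has `f(w) = O(w)`, so `f(q) = 4^k f(q^(2^k)) = O(4^k |q|^(2^k))`. Since `4^k =
  -- (2^k)²`, this is `m² |q|^m` along `m = 2^k`, which tends to `0`.
  have hO := hf.isBigO_sub.comp_tendsto (tendsto_pow_two_pow hq)
  simp only [Function.comp_def, h0, sub_zero] at hO
  have hO2 := (Asymptotics.isBigO_refl (fun k : ℕ => (4 : ℂ) ^ k) atTop).mul hO
  simp only [← hk] at hO2
  have hlim : Tendsto (fun k : ℕ => (4 : ℂ) ^ k * q ^ 2 ^ k) atTop (𝓝 0) := by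
    have h1 := (tendsto_pow_const_mul_const_pow_of_abs_lt_one 2 (r := ‖q‖)
      (by rwa [abs_norm])).comp (tendsto_pow_atTop_atTop_of_one_lt one_lt_two)
    rw [tendsto_zero_iff_norm_tendsto_zero]
    refine h1.congr fun k => ?_
    simp only [Function.comp_def, norm_mul, norm_pow, Complex.norm_ofNat, Nat.cast_pow,
      Nat.cast_ofNat]
    rw [← pow_mul, mul_comm k 2, pow_mul]; norm_num
  exact tendsto_nhds_unique tendsto_const_nhds (hO2.trans_tendsto hlim)

theorem continuousAt_zero_of_differentiableOn {f : ℂ → ℂ}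
    (hf : DifferentiableOn ℂ f (Metric.ball 0 1)) : ContinuousAt f 0 :=
  (hf.differentiableAt (Metric.ball_mem_nhds 0 one_pos)).continuousAt

theorem theta4_ne_zero (hq : ‖q‖ < 1) : theta4 q ≠ 0 := by
  refine ne_zero_of_sq_zero (continuousAt_zero_of_differentiableOn differentiableOn_theta4)
    (by simp [theta4_zero]) (fun w hw h => ?_) hq
  have := theta3'_mul_theta4 hw
  rw [h, mul_zero] at this
  exact pow_eq_zero_iff two_ne_zero |>.1 this.symm

theorem theta3'_ne_zero (hq : ‖q‖ < 1) : theta3' q ≠ 0 := by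
  rw [theta3'_eq_theta4_neg]; exact theta4_ne_zero (by simpa using hq)

theorem psi_ne_zero (hq : ‖q‖ < 1) : psi q ≠ 0 := by
  refine ne_zero_of_sq_zero (continuousAt_zero_of_differentiableOn differentiableOn_psi)
    (by simp [psi_zero]) (fun w hw h => ?_) hq
  have := psi_mul_self hw
  rw [h, zero_pow two_ne_zero] at this
  simpa [theta3'_ne_zero (norm_sq_lt_one hw)] using this.symm

/-! ### Logarithmic derivatives of the theta functions. -/

/-- `q d/dq log θ₂`. -/
def logD2 (q : ℂ) : ℂ := 1 / 4 + qD psi q / psi q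

/-- `q d/dq log θ₃`. -/
def logD3 (q : ℂ) : ℂ := qD theta3' q / theta3' q

/-- `q d/dq log θ₄`. -/
def logD4 (q : ℂ) : ℂ := qD theta4 q / theta4 q

theorem hasQD_psi (hq : ‖q‖ < 1) : HasQD psi ((logD2 q - 1 / 4) * psi q) q :=
  (HasQD.of_differentiableOn differentiableOn_psi hq).congr_eq
    (by rw [logD2]; field_simp [psi_ne_zero hq]; ring)

theorem hasQD_theta3' (hq : ‖q‖ < 1) : HasQD theta3' (logD3 q * theta3' q) q :=
  (HasQD.of_differentiableOn differentiableOn_theta3' hq).congr_eq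
    (by rw [logD3, div_mul_cancel₀ _ (theta3'_ne_zero hq)])

theorem hasQD_theta4 (hq : ‖q‖ < 1) : HasQD theta4 (logD4 q * theta4 q) q :=
  (HasQD.of_differentiableOn differentiableOn_theta4 hq).congr_eq
    (by rw [logD4, div_mul_cancel₀ _ (theta4_ne_zero hq)])

/-- Apply `q d/dq` to `θ₃(q)² = θ₃(q²)² + θ₂(q²)²`. The other duplication rules for logarithmic
derivatives arise in the same way. -/
theorem logD3_duplication (hq : ‖q‖ < 1) :
    logD3 q * theta3' q ^ 2 =
      2 * (logD3 (q ^ 2) * theta3' (q ^ 2) ^ 2 + logD2 (q ^ 2) * (q * psi (q ^ 2) ^ 2)) := by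
  have hq2 := norm_sq_lt_one hq
  have h := ((hasQD_theta3' hq).pow 2).unique
    ((((hasQD_theta3' hq2).comp_sq.pow 2).add ((HasQD.id q).mul
      ((hasQD_psi hq2).comp_sq.pow 2))).congr_disc hq fun w hw => theta3'_mul_self hw)
  push_cast at h
  linear_combination (1 / 2) * h

theorem logD4_duplication (hq : ‖q‖ < 1) :
    logD4 q * theta4 q ^ 2 =
      2 * (logD3 (q ^ 2) * theta3' (q ^ 2) ^ 2 - logD2 (q ^ 2) * (q * psi (q ^ 2) ^ 2)) := by
  have hq2 := norm_sq_lt_one hq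
  have h := ((hasQD_theta4 hq).pow 2).unique
    ((((hasQD_theta3' hq2).comp_sq.pow 2).sub ((HasQD.id q).mul
      ((hasQD_psi hq2).comp_sq.pow 2))).congr_disc hq fun w hw => theta4_mul_self hw)
  push_cast at h
  linear_combination (1 / 2) * h

theorem logD2_duplication (hq : ‖q‖ < 1) : logD2 q = logD2 (q ^ 2) + logD3 (q ^ 2) := by
  have hq2 := norm_sq_lt_one hq
  have h := ((hasQD_psi hq).pow 2).unique
    ((((hasQD_psi hq2).comp_sq.const_mul 2).mul (hasQD_theta3' hq2).comp_sq).congr_disc hq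
      fun w hw => psi_mul_self hw)
  push_cast at h
  refine mul_right_cancel₀ (pow_ne_zero 2 (psi_ne_zero hq)) ?_
  linear_combination (1 / 2) * h + (1 / 4 - logD2 (q ^ 2) - logD3 (q ^ 2)) * psi_mul_self hq

theorem logD3_add_logD4 (hq : ‖q‖ < 1) : logD3 q + logD4 q = 4 * logD4 (q ^ 2) := by
  have hq2 := norm_sq_lt_one hq
  have h := ((hasQD_theta3' hq).mul (hasQD_theta4 hq)).unique
    (((hasQD_theta4 hq2).comp_sq.pow 2).congr_disc hq fun w hw => theta3'_mul_theta4 hw)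
  push_cast at h
  refine mul_right_cancel₀ (mul_ne_zero (theta3'_ne_zero hq) (theta4_ne_zero hq)) ?_
  linear_combination h - 4 * logD4 (q ^ 2) * theta3'_mul_theta4 hq

theorem theta4_sq_pow_four (hq : ‖q‖ < 1) : theta4 (q ^ 2) ^ 4 =
    (theta3' (q ^ 2) ^ 2) ^ 2 - (q * psi (q ^ 2) ^ 2) ^ 2 := by
  have h := theta3'_mul_theta4 hq
  have h3 := theta3'_mul_self hq
  have h4 := theta4_mul_self hq
  rw [show theta4 (q ^ 2) ^ 4 = theta3' q ^ 2 * theta4 q ^ 2 by rw [← mul_pow, h]; ring, h3, h4]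
  ring

theorem differentiableOn_qD {f : ℂ → ℂ} (hf : DifferentiableOn ℂ f (Metric.ball 0 1)) :
    DifferentiableOn ℂ (qD f) (Metric.ball 0 1) :=
  differentiableOn_id.mul (hf.deriv Metric.isOpen_ball)

theorem differentiableOn_logD2 : DifferentiableOn ℂ logD2 (Metric.ball 0 1) :=
  (differentiableOn_const _).add ((differentiableOn_qD differentiableOn_psi).div
    differentiableOn_psi fun _ h => psi_ne_zero (mem_ball_zero_iff.1 h))

theorem differentiableOn_logD3 : DifferentiableOn ℂ logD3 (Metric.ball 0 1) :=
  (differentiableOn_qD differentiableOn_theta3').div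
    differentiableOn_theta3' fun _ h => theta3'_ne_zero (mem_ball_zero_iff.1 h)

theorem differentiableOn_logD4 : DifferentiableOn ℂ logD4 (Metric.ball 0 1) :=
  (differentiableOn_qD differentiableOn_theta4).div
    differentiableOn_theta4 fun _ h => theta4_ne_zero (mem_ball_zero_iff.1 h)

theorem logD2_zero : logD2 0 = 1 / 4 := by simp [logD2, qD]

theorem logD3_zero : logD3 0 = 0 := by simp [logD3, qD]

theorem logD4_zero : logD4 0 = 0 := by simp [logD4, qD]

/-- The quotient by `θ₄⁴` is invariant under `q ↦ q²`, hence equals its value `1/4` at `0`. With `X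
= θ₃(q²)²` and `Y = θ₂(q²)²`, passing from `q²` to `q` multiplies the left side by `(X - Y)/(X +
Y)`, and `θ₄⁴` likewise goes from `X² - Y²` to `(X - Y)²`. -/
theorem logD2_sub_logD3 (hq : ‖q‖ < 1) : logD2 q - logD3 q = theta4 q ^ 4 / 4 := by
  have hd : DifferentiableOn ℂ (fun q => (logD2 q - logD3 q) / theta4 q ^ 4) (Metric.ball 0 1) :=
    (differentiableOn_logD2.sub differentiableOn_logD3).div (differentiableOn_theta4.pow 4)
      fun _ h => pow_ne_zero 4 (theta4_ne_zero (mem_ball_zero_iff.1 h))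
  have h := eq_apply_zero_of_sq_invariant (continuousAt_zero_of_differentiableOn hd)
    (fun w hw => ?_) hq
  · rw [div_eq_iff (pow_ne_zero 4 (theta4_ne_zero hq))] at h
    rw [h, logD2_zero, logD3_zero, theta4_zero]; ring
  · have hw2 := norm_sq_lt_one hw
    rw [div_eq_div_iff (pow_ne_zero 4 (theta4_ne_zero hw)) (pow_ne_zero 4 (theta4_ne_zero hw2)),
      theta4_sq_pow_four hw, show theta4 w ^ 4 = (theta4 w ^ 2) ^ 2 by ring, theta4_mul_self hw,
      logD2_duplication hw]
    have h3 := logD3_duplication hw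
    rw [theta3'_mul_self hw] at h3
    linear_combination -(theta3' (w ^ 2) ^ 2 - w * psi (w ^ 2) ^ 2) * h3

/-- `θ₂⁴` as a function holomorphic in the disc. -/
def theta2Four (q : ℂ) : ℂ := q * psi q ^ 4

/-- `θ₃⁴`. -/
def theta3Four (q : ℂ) : ℂ := theta3' q ^ 4

theorem theta2Four_duplication (hq : ‖q‖ < 1) :
    theta2Four q = 4 * (q * psi (q ^ 2) ^ 2) * theta3' (q ^ 2) ^ 2 := by
  rw [theta2Four, show psi q ^ 4 = (psi q ^ 2) ^ 2 by ring, psi_mul_self hq]; ring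

theorem theta3Four_duplication (hq : ‖q‖ < 1) :
    theta3Four q = (theta3' (q ^ 2) ^ 2 + q * psi (q ^ 2) ^ 2) ^ 2 := by
  rw [theta3Four, show theta3' q ^ 4 = (theta3' q ^ 2) ^ 2 by ring, theta3'_mul_self hq]

/-- Jacobi's quartic identity: in the `X`, `Y` of the duplication formulas it reads `(X - Y)² = (X +
Y)² - 4XY`. -/
theorem theta4_pow_four (hq : ‖q‖ < 1) : theta4 q ^ 4 = theta3Four q - theta2Four q := by
  rw [theta2Four_duplication hq, theta3Four_duplication hq,
    show theta4 q ^ 4 = (theta4 q ^ 2) ^ 2 by ring, theta4_mul_self hq]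
  ring

theorem logD3_sub_logD4 (hq : ‖q‖ < 1) : logD3 q - logD4 q = theta2Four q / 4 := by
  have hq2 := norm_sq_lt_one hq
  refine mul_right_cancel₀ (pow_ne_zero 4 (theta4_ne_zero hq2)) ?_
  have h3 := logD3_duplication hq
  have h4 := logD4_duplication hq
  have h23 := logD2_sub_logD3 hq2
  rw [theta3'_mul_self hq] at h3
  rw [theta4_mul_self hq] at h4
  rw [theta4_sq_pow_four hq] at h23 ⊢
  rw [theta2Four_duplication hq]
  linear_combination (theta3' (q ^ 2) ^ 2 - q * psi (q ^ 2) ^ 2) * h3 -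
    (theta3' (q ^ 2) ^ 2 + q * psi (q ^ 2) ^ 2) * h4 +
    4 * (q * psi (q ^ 2) ^ 2) * theta3' (q ^ 2) ^ 2 * h23

theorem logD2_sub_logD4 (hq : ‖q‖ < 1) : logD2 q - logD4 q = theta3Four q / 4 := by
  linear_combination logD2_sub_logD3 hq + logD3_sub_logD4 hq + theta4_pow_four hq / 4

theorem two_mul_logD4_sq (hq : ‖q‖ < 1) : 2 * logD4 (q ^ 2) - logD4 q = theta2Four q / 8 := by
  linear_combination (1 / 2) * logD3_sub_logD4 hq - (1 / 2) * logD3_add_logD4 hq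

theorem hasQD_theta2Four (hq : ‖q‖ < 1) :
    HasQD theta2Four (4 * logD2 q * theta2Four q) q :=
  ((HasQD.id q).mul ((hasQD_psi hq).pow 4)).congr_eq (by rw [theta2Four]; push_cast; ring)

theorem hasQD_theta3Four (hq : ‖q‖ < 1) :
    HasQD theta3Four (4 * logD3 q * theta3Four q) q :=
  ((hasQD_theta3' hq).pow 4).congr_eq (by rw [theta3Four]; push_cast; ring)

theorem differentiableOn_theta2Four : DifferentiableOn ℂ theta2Four (Metric.ball 0 1) :=
  differentiableOn_id.mul (differentiableOn_psi.pow 4)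

theorem differentiableOn_theta3Four : DifferentiableOn ℂ theta3Four (Metric.ball 0 1) :=
  differentiableOn_theta3'.pow 4

/-- The difference `f` of the two sides satisfies `f(q) = 4 f(q²)`, so it vanishes. This is the only
second-order identity needed, and it yields Ramanujan's equation for `E₂`. -/
theorem qD_logD4 (hq : ‖q‖ < 1) :
    qD logD4 q = 2 * logD4 q ^ 2 - theta2Four q * theta3Four q / 8 := by
  have hd : DifferentiableOn ℂ
      (fun q => qD logD4 q - 2 * logD4 q ^ 2 + theta2Four q * theta3Four q / 8)
      (Metric.ball 0 1) :=
    ((differentiableOn_qD differentiableOn_logD4).sub ((differentiableOn_logD4.pow 2).const_mul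
      2)).add ((differentiableOn_theta2Four.mul differentiableOn_theta3Four).div_const 8)
  have h := eq_zero_of_eq_four_mul_sq (hd.differentiableAt (Metric.ball_mem_nhds 0 one_pos))
    (fun w hw => ?_) hq
  · linear_combination h
  · have hw2 := norm_sq_lt_one hw
    -- Differentiating `2 logD4(q²) - logD4(q) = θ₂⁴/8` relates `D logD4` at `w²` and at `w`.
    have h1 := (((HasQD.of_differentiableOn differentiableOn_logD4 hw2).comp_sq.const_mul 2).sub
      (HasQD.of_differentiableOn differentiableOn_logD4 hw)).unique
      (((hasQD_theta2Four hw).const_mul (1 / 8)).congr_disc hw fun w hw => by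
        rw [two_mul_logD4_sq hw]; ring)
    have h2 := two_mul_logD4_sq hw
    have h3 := logD2_sub_logD4 hw
    have ha := theta2Four_duplication hw
    have hb : theta2Four (w ^ 2) * theta3Four (w ^ 2) = theta2Four w ^ 2 / 16 := by
      rw [ha, theta2Four, theta3Four]; ring
    have h4 : logD4 (w ^ 2) = logD4 w / 2 + theta2Four w / 16 := by linear_combination h2 / 2
    rw [hb, h4]
    linear_combination -h1 - theta2Four w / 2 * h3

/-! ### Central factorials and Chebyshev coefficients. -/

/-- `∏_{j < t} (x² - j²)`. -/
def sqFactorial (t : ℕ) (x : ℂ) : ℂ := ∏ j ∈ range t, (x ^ 2 - (j : ℂ) ^ 2)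

theorem sqFactorial_shift (k : ℕ) (x : ℂ) :
    sqFactorial (k + 2) (x + 1) =
      x * (x + 1) * (x + k + 1) * (x + k + 2) * ∏ j ∈ range k, (x ^ 2 - ((j : ℂ) + 1) ^ 2) := by
  induction k with
  | zero => simp [sqFactorial, prod_range_succ]; ring
  | succ k ih =>
    rw [sqFactorial, prod_range_succ, ← sqFactorial, ih, prod_range_succ]
    push_cast; ring

theorem sqFactorial_neg (k : ℕ) (x : ℂ) : sqFactorial k (-x) = sqFactorial k x := by
  simp [sqFactorial]

theorem sqFactorial_second_difference (t : ℕ) (x : ℂ) :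
    sqFactorial (t + 1) (x + 1) + sqFactorial (t + 1) (x - 1) - 2 * sqFactorial (t + 1) x =
      (2 * t + 1) * (2 * t + 2) * sqFactorial t x := by
  rcases t with _ | k
  · simp [sqFactorial]; ring
  · have h1 := sqFactorial_shift k x
    have h2 := sqFactorial_shift k (-x)
    rw [show -x + 1 = -(x - 1) by ring, sqFactorial_neg, neg_sq] at h2
    have h3 : sqFactorial (k + 1) x = x ^ 2 * ∏ j ∈ range k, (x ^ 2 - ((j : ℂ) + 1) ^ 2) := by
      rw [sqFactorial, prod_range_succ', mul_comm]; simp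
    have h4 : sqFactorial (k + 2) x = sqFactorial (k + 1) x * (x ^ 2 - (k + 1) ^ 2) := by
      rw [sqFactorial, prod_range_succ, ← sqFactorial]; push_cast; ring
    rw [h1, h2, h4, h3]; push_cast; ring

/-- For an integer `n`, the coefficient of `X^t` in the Chebyshev polynomial `Tₙ(1 - X/2)`,
as a polynomial in `n`. -/
def chebCoeff (t : ℕ) (x : ℂ) : ℂ := (-1) ^ t / ((2 * t).factorial : ℂ) * sqFactorial t x

theorem chebCoeff_zero (x : ℂ) : chebCoeff 0 x = 1 := by simp [chebCoeff, sqFactorial]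

theorem chebCoeff_succ_zero (t : ℕ) : chebCoeff (t + 1) 0 = 0 := by
  simp [chebCoeff, sqFactorial, prod_range_succ']

/-- This is the `X^(t+1)` coefficient of the Chebyshev recurrence `T_{n+1} + T_{n-1} = (2 - X) T_n`
at `1 - X/2`. -/
theorem chebCoeff_second_difference (t : ℕ) (x : ℂ) :
    chebCoeff (t + 1) (x + 1) + chebCoeff (t + 1) (x - 1) - 2 * chebCoeff (t + 1) x =
      -chebCoeff t x := by
  have h := sqFactorial_second_difference t x
  have hf : ((2 * (t + 1)).factorial : ℂ) = (2 * t + 2) * (2 * t + 1) * (2 * t).factorial := by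
    rw [show 2 * (t + 1) = 2 * t + 1 + 1 by ring, Nat.factorial_succ, Nat.factorial_succ]
    push_cast; ring
  have h0 : ((2 * t).factorial : ℂ) ≠ 0 := by exact_mod_cast Nat.factorial_ne_zero _
  have h1 : (2 * t + 2 : ℂ) ≠ 0 := by exact_mod_cast (show 2 * t + 2 ≠ 0 by omega)
  have h2 : (2 * t + 1 : ℂ) ≠ 0 := by exact_mod_cast (show 2 * t + 1 ≠ 0 by omega)
  simp only [chebCoeff]
  rw [hf, show (-1 : ℂ) ^ (t + 1) / ((2 * t + 2) * (2 * t + 1) * (2 * t).factorial) =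
    (-1) ^ t / (2 * t).factorial * (-1 / ((2 * t + 2) * (2 * t + 1))) by
      rw [pow_succ]; field_simp]
  have h3 : sqFactorial t x = (sqFactorial (t + 1) (x + 1) + sqFactorial (t + 1) (x - 1) -
      2 * sqFactorial (t + 1) x) / ((2 * t + 2) * (2 * t + 1)) := by
    rw [h]; field_simp
  rw [h3]; ring

/-! ### The finite Jacobi triple product. -/

/-- `(q²; q²)_m`. -/
def qPoch (q : ℂ) (m : ℕ) : ℂ := ∏ i ∈ range m, (1 - (q ^ 2) ^ (i + 1))

/-- `1 / (q²; q²)_m`, extended by `0` to negative `m`. -/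
def qPochInv (q : ℂ) (m : ℤ) : ℂ := if m < 0 then 0 else (qPoch q m.toNat)⁻¹

/-- The coefficient of `zⁿ` in `∏_{s ≤ N} (1 - z q^(2s-1)) (1 - z⁻¹ q^(2s-1))`. -/
def finiteTheta (q : ℂ) (N : ℕ) (n : ℤ) : ℂ :=
  (-1) ^ n.natAbs * q ^ (n.natAbs ^ 2) * (qPoch q (2 * N) * qPochInv q (N + n) * qPochInv q (N - n))

theorem one_sub_pow_ne_zero {w : ℂ} (hw : ‖w‖ < 1) {k : ℕ} (hk : k ≠ 0) : 1 - w ^ k ≠ 0 := by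
  intro h
  have : ‖w ^ k‖ < 1 := by rw [norm_pow]; exact pow_lt_one₀ (norm_nonneg _) hw hk
  rw [← sub_eq_zero.1 h, norm_one] at this
  exact lt_irrefl _ this

theorem qPoch_ne_zero (hq : ‖q‖ < 1) (m : ℕ) : qPoch q m ≠ 0 :=
  prod_ne_zero_iff.2 fun i _ => one_sub_pow_ne_zero (norm_sq_lt_one hq) i.succ_ne_zero

theorem qPochInv_sub_one (hq : ‖q‖ < 1) (m : ℤ) :
    qPochInv q (m - 1) = (1 - q ^ (2 * m)) * qPochInv q m := by
  rcases lt_trichotomy m 0 with h | rfl | h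
  · simp [qPochInv, h, show m - 1 < 0 by omega]
  · simp [qPochInv]
  · obtain ⟨k, rfl⟩ : ∃ k : ℕ, m = k + 1 := ⟨(m - 1).toNat, by omega⟩
    have h1 : ¬ ((k : ℤ) + 1 - 1 < 0) := by omega
    have h2 : ¬ ((k : ℤ) + 1 < 0) := by omega
    have h3 : ((k : ℤ) + 1 - 1).toNat = k := by omega
    have h4 : ((k : ℤ) + 1).toNat = k + 1 := by omega
    have h5 : q ^ (2 * ((k : ℤ) + 1)) = (q ^ 2) ^ (k + 1) := by
      rw [← pow_mul, ← zpow_natCast]; push_cast; rfl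
    rw [qPochInv, qPochInv, if_neg h1, if_neg h2, h3, h4, h5]
    have h6 : qPoch q (k + 1) = qPoch q k * (1 - (q ^ 2) ^ (k + 1)) := prod_range_succ _ _
    have h7 := qPoch_ne_zero hq k
    have h8 : 1 - (q ^ 2) ^ (k + 1) ≠ 0 := one_sub_pow_ne_zero (norm_sq_lt_one hq) k.succ_ne_zero
    rw [h6]
    field_simp

theorem finiteTheta_eq_zero {N : ℕ} {n : ℤ} (h : (N : ℤ) < |n|) : finiteTheta q N n = 0 := by
  rcases lt_abs.1 h with h | h
  · simp [finiteTheta, qPochInv, show (N : ℤ) - n < 0 by omega]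
  · simp [finiteTheta, qPochInv, show (N : ℤ) + n < 0 by omega]

theorem finiteTheta_support (N : ℕ) (f : ℤ → ℂ) :
    (Function.support fun n => finiteTheta q N n * f n).Finite := by
  refine (Set.finite_Icc (-(N : ℤ)) N).subset fun n hn => ?_
  by_contra h
  refine hn ?_
  simp only
  rw [finiteTheta_eq_zero, zero_mul]
  rw [Set.mem_Icc, ← abs_le, not_le] at h
  exact h

theorem neg_one_pow_natAbs (n : ℤ) : (-1 : ℂ) ^ n.natAbs = (-1) ^ n := by
  rcases Int.even_or_odd n with h | h
  · rw [(Int.natAbs_even.2 h).neg_one_pow, h.neg_one_zpow]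
  · rw [(Int.natAbs_odd.2 h).neg_one_pow, h.neg_one_zpow]

theorem pow_natAbs_sq (n : ℤ) : q ^ (n.natAbs ^ 2) = q ^ (n ^ 2) := by
  rw [← zpow_natCast]; push_cast; rw [sq_abs]

/-- Compare coefficients of `zⁿ` when multiplying by the next factor `(1 - zw)(1 - z⁻¹w) = 1 + w² -
w(z + z⁻¹)`, `w = q^(2N+1)`. The convention `1/(q²; q²)_m = 0` for `m < 0` makes it hold for all
integers `n`. -/
theorem finiteTheta_succ (hq : ‖q‖ < 1) (h0 : q ≠ 0) (N : ℕ) (n : ℤ) :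
    finiteTheta q (N + 1) n = (1 + (q ^ (2 * N + 1)) ^ 2) * finiteTheta q N n -
      q ^ (2 * N + 1) * (finiteTheta q N (n - 1) + finiteTheta q N (n + 1)) := by
  set α := q ^ (2 * ((N : ℤ) + 1 + n)) with hα
  set β := q ^ (2 * ((N : ℤ) + 1 - n)) with hβ
  set x := qPochInv q ((N : ℤ) + 1 + n) with hx
  set y := qPochInv q ((N : ℤ) + 1 - n) with hy
  have hx1 : qPochInv q ((N : ℤ) + n) = (1 - α) * x := by
    rw [← qPochInv_sub_one hq]; congr 1; ring
  have hy1 : qPochInv q ((N : ℤ) - n) = (1 - β) * y := by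
    rw [← qPochInv_sub_one hq]; congr 1; ring
  have hα2 : q ^ (2 * ((N : ℤ) + n)) = α / q ^ 2 := by
    rw [hα, eq_div_iff (pow_ne_zero 2 h0), ← zpow_natCast, ← zpow_add₀ h0]; congr 1; push_cast; ring
  have hβ2 : q ^ (2 * ((N : ℤ) - n)) = β / q ^ 2 := by
    rw [hβ, eq_div_iff (pow_ne_zero 2 h0), ← zpow_natCast, ← zpow_add₀ h0]; congr 1; push_cast; ring
  have hx2 : qPochInv q ((N : ℤ) + (n - 1)) = (1 - α / q ^ 2) * ((1 - α) * x) := by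
    rw [← hx1, ← hα2, ← qPochInv_sub_one hq]; congr 1; ring
  have hy2 : qPochInv q ((N : ℤ) - (n + 1)) = (1 - β / q ^ 2) * ((1 - β) * y) := by
    rw [← hy1, ← hβ2, ← qPochInv_sub_one hq]; congr 1; ring
  have hx3 : qPochInv q ((N : ℤ) + (n + 1)) = x := by rw [hx]; congr 1; ring
  have hy3 : qPochInv q ((N : ℤ) - (n - 1)) = y := by rw [hy]; congr 1; ring
  have hαβ : q ^ (4 * N + 4) = α * β := by
    rw [hα, hβ, ← zpow_add₀ h0, ← zpow_natCast]; congr 1; push_cast; ring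
  have hw2 : (q ^ (2 * N + 1)) ^ 2 = α * β / q ^ 2 := by
    rw [eq_div_iff (pow_ne_zero 2 h0), ← hαβ]; ring
  have hP : qPoch q (2 * (N + 1)) = qPoch q (2 * N) * ((1 - α * β / q ^ 2) * (1 - α * β)) := by
    rw [show 2 * (N + 1) = 2 * N + 1 + 1 by ring, qPoch, prod_range_succ, prod_range_succ, ← qPoch,
      ← hw2, ← hαβ]
    ring
  have hs1 : q ^ (2 * N + 1) * q ^ ((n - 1).natAbs ^ 2) = β * q ^ (n.natAbs ^ 2) := by
    rw [pow_natAbs_sq, pow_natAbs_sq, hβ, ← zpow_natCast, ← zpow_add₀ h0, ← zpow_add₀ h0]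
    congr 1; push_cast; ring
  have hs2 : q ^ (2 * N + 1) * q ^ ((n + 1).natAbs ^ 2) = α * q ^ (n.natAbs ^ 2) := by
    rw [pow_natAbs_sq, pow_natAbs_sq, hα, ← zpow_natCast, ← zpow_add₀ h0, ← zpow_add₀ h0]
    congr 1; push_cast; ring
  have hn1 : (-1 : ℂ) ^ (n - 1).natAbs = -(-1) ^ n.natAbs := by
    rw [neg_one_pow_natAbs, neg_one_pow_natAbs, zpow_sub₀ (by norm_num), zpow_one, div_neg, div_one]
  have hn2 : (-1 : ℂ) ^ (n + 1).natAbs = -(-1) ^ n.natAbs := by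
    rw [neg_one_pow_natAbs, neg_one_pow_natAbs, zpow_add₀ (by norm_num)]; simp
  simp only [finiteTheta]
  rw [hx1, hy1, hx2, hy2, hx3, hy3, hn1, hn2, hP, hw2, Nat.cast_add, Nat.cast_one, ← hx, ← hy]
  linear_combination (-1) ^ n.natAbs * qPoch q (2 * N) * x * y *
    (-(1 - α / q ^ 2) * (1 - α) * hs1 - (1 - β / q ^ 2) * (1 - β) * hs2)

/-- `∑_{0 ≤ s_1 < ⋯ < s_t < N} ∏ u(s_i)`. -/
def partialEsymm (u : ℕ → ℂ) (N t : ℕ) : ℂ := ∑ s ∈ powersetCard t (range N), ∏ i ∈ s, u i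

theorem partialEsymm_zero_right (u : ℕ → ℂ) (N : ℕ) : partialEsymm u N 0 = 1 := by
  simp [partialEsymm]

theorem partialEsymm_zero_left (u : ℕ → ℂ) (t : ℕ) : partialEsymm u 0 (t + 1) = 0 := by
  rw [partialEsymm, powersetCard_eq_empty.2 (by simp), sum_empty]

theorem partialEsymm_succ (u : ℕ → ℂ) (N t : ℕ) :
    partialEsymm u (N + 1) (t + 1) = partialEsymm u N (t + 1) + u N * partialEsymm u N t := by
  have hN : N ∉ range N := by simp
  rw [partialEsymm, range_add_one, powersetCard_succ_insert hN, sum_union, sum_image]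
  · congr 1
    rw [partialEsymm, mul_sum]
    refine sum_congr rfl fun s hs => prod_insert fun h => hN ((mem_powersetCard.1 hs).1 h)
  · intro s hs s' hs' h
    have h1 : N ∉ s := fun h => hN ((mem_powersetCard.1 hs).1 h)
    have h2 : N ∉ s' := fun h => hN ((mem_powersetCard.1 hs').1 h)
    rw [← erase_insert h1, ← erase_insert h2, h]
  · rw [disjoint_left]
    intro s hs hs'
    obtain ⟨s', _, rfl⟩ := mem_image.1 hs'
    exact hN ((mem_powersetCard.1 hs).1 (mem_insert_self _ _))

/-- `q^(2s+1) / (1 - q^(2s+1))²`. -/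
def oddTerm (q : ℂ) (s : ℕ) : ℂ := q ^ (2 * s + 1) / (1 - q ^ (2 * s + 1)) ^ 2

/-- Induction on `N`. Summation by parts moves the shifts of `finiteTheta_succ` onto the test
function, where `1 + w² - w(shifts)` equals `(1 - w)²` minus `w` times the second difference. On
`chebCoeff (t + 1)` this gives `(1 - w)² c_{t+1} + w c_t`, the recursion of `partialEsymm_succ`
multiplied by `(1 - w)²`. -/
theorem partialEsymm_oddTerm (hq : ‖q‖ < 1) (h0 : q ≠ 0) (N t : ℕ) :
    partialEsymm (oddTerm q) N t * ∏ s ∈ range N, (1 - q ^ (2 * s + 1)) ^ 2 =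
      ∑' n : ℤ, finiteTheta q N n * chebCoeff t n := by
  have hsum : ∀ (N : ℕ) (f : ℤ → ℂ), Summable fun n => finiteTheta q N n * f n :=
    fun N f => summable_of_hasFiniteSupport (finiteTheta_support N f)
  have hstep : ∀ (N : ℕ) (f : ℤ → ℂ), ∑' n, finiteTheta q (N + 1) n * f n =
      ∑' n, finiteTheta q N n * ((1 + (q ^ (2 * N + 1)) ^ 2) * f n -
        q ^ (2 * N + 1) * (f (n + 1) + f (n - 1))) := by
    intro N f
    have e1 := (Equiv.addRight (1 : ℤ)).tsum_eq (fun n => finiteTheta q N (n - 1) * f n)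
    have e2 := (Equiv.subRight (1 : ℤ)).tsum_eq (fun n => finiteTheta q N (n + 1) * f n)
    have s1 := (Equiv.addRight (1 : ℤ)).summable_iff (f := fun n => finiteTheta q N (n - 1) * f n)
    have s2 := (Equiv.subRight (1 : ℤ)).summable_iff (f := fun n => finiteTheta q N (n + 1) * f n)
    simp only [Function.comp_def, Equiv.coe_addRight, Equiv.subRight_apply, add_sub_cancel_right,
      sub_add_cancel] at e1 e2 s1 s2
    have t0 := (hsum N f).mul_left (1 + (q ^ (2 * N + 1)) ^ 2)
    have t1 := (hsum N fun n => f (n + 1))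
    have t2 := (hsum N fun n => f (n - 1))
    calc ∑' n, finiteTheta q (N + 1) n * f n
        = ∑' n, ((1 + (q ^ (2 * N + 1)) ^ 2) * (finiteTheta q N n * f n) - q ^ (2 * N + 1) *
          (finiteTheta q N (n - 1) * f n + finiteTheta q N (n + 1) * f n)) :=
          tsum_congr fun n => by rw [finiteTheta_succ hq h0]; ring
      _ = ∑' n, ((1 + (q ^ (2 * N + 1)) ^ 2) * (finiteTheta q N n * f n) - q ^ (2 * N + 1) *
          (finiteTheta q N n * f (n + 1) + finiteTheta q N n * f (n - 1))) := by
          rw [t0.tsum_sub (((s1.1 t1).add (s2.1 t2)).mul_left _), tsum_mul_left (a := q ^ (2 * N + 1)),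
            (s1.1 t1).tsum_add (s2.1 t2), ← e1, ← e2, ← t1.tsum_add t2, ← tsum_mul_left,
            ← t0.tsum_sub ((t1.add t2).mul_left _)]
      _ = _ := tsum_congr fun n => by ring
  induction N generalizing t with
  | zero =>
    rw [tsum_eq_single 0 fun n hn => by
      rw [finiteTheta_eq_zero (by simpa using hn), zero_mul]]
    rcases t with _ | t
    · simp [partialEsymm_zero_right, chebCoeff_zero, finiteTheta, qPoch, qPochInv]
    · simp [partialEsymm_zero_left, chebCoeff_succ_zero]
  | succ N ih =>
    have hw : (1 - q ^ (2 * N + 1)) ≠ 0 := one_sub_pow_ne_zero hq (by omega)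
    rw [hstep, prod_range_succ]
    rcases t with _ | t
    · have := ih 0
      rw [partialEsymm_zero_right, one_mul] at this ⊢
      rw [this, ← tsum_mul_right]
      refine tsum_congr fun n => ?_
      simp only [chebCoeff_zero]; ring
    · have hu : oddTerm q N * (1 - q ^ (2 * N + 1)) ^ 2 = q ^ (2 * N + 1) := by
        rw [oddTerm, div_mul_cancel₀ _ (pow_ne_zero 2 hw)]
      calc _ = (1 - q ^ (2 * N + 1)) ^ 2 * (partialEsymm (oddTerm q) N (t + 1) *
              ∏ s ∈ range N, (1 - q ^ (2 * s + 1)) ^ 2) + q ^ (2 * N + 1) *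
              (partialEsymm (oddTerm q) N t * ∏ s ∈ range N, (1 - q ^ (2 * s + 1)) ^ 2) := by
            rw [partialEsymm_succ]
            linear_combination partialEsymm (oddTerm q) N t *
              (∏ s ∈ range N, (1 - q ^ (2 * s + 1)) ^ 2) * hu
        _ = _ := by
            rw [ih, ih, ← tsum_mul_left, ← tsum_mul_left, ← ((hsum N _).mul_left _).tsum_add
              ((hsum N _).mul_left _)]
            refine tsum_congr fun n => ?_
            have := chebCoeff_second_difference t n
            push_cast
            linear_combination finiteTheta q N n * q ^ (2 * N + 1) * this

/-! ### Passing to infinitely many factors. -/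

theorem exists_tendsto_qPoch (hq : ‖q‖ < 1) :
    ∃ L : ℂ, L ≠ 0 ∧ Tendsto (qPoch q) atTop (𝓝 L) := by
  have hq2 := norm_sq_lt_one hq
  have hs : Summable fun i : ℕ => ‖-(q ^ 2) ^ (i + 1)‖ := by
    refine ((summable_nat_add_iff 1).2 (summable_geometric_of_lt_one (norm_nonneg _) hq2)).congr
      fun i => ?_
    rw [norm_neg, norm_pow (q ^ 2) (i + 1)]
  refine ⟨∏' i : ℕ, (1 + -(q ^ 2) ^ (i + 1)), tprod_one_add_ne_zero_of_summable (fun i => ?_) hs, ?_⟩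
  · rw [← sub_eq_add_neg]; exact one_sub_pow_ne_zero hq2 i.succ_ne_zero
  · have := (multipliable_one_add_of_summable hs).hasProd.tendsto_prod_nat
    simp only [← sub_eq_add_neg] at this ⊢
    exact this

theorem discSummable_sqFactorial (t : ℕ) :
    DiscSummable (fun n : ℤ => (-1) ^ n.natAbs * sqFactorial t n) fun n => n.natAbs ^ 2 := by
  induction t with
  | zero => simpa [sqFactorial] using discSummable_theta4
  | succ t ih =>
    intro r h0 h1
    refine ((ih.natCast_mul r h0 h1).add ((ih r h0 h1).mul_left ‖(t : ℂ) ^ 2‖)).of_nonneg_of_le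
      (fun n => by positivity) fun n => ?_
    beta_reduce
    rw [natCast_natAbs_sq, sqFactorial, prod_range_succ, ← sqFactorial,
      show ∀ a b c d : ℂ, a * (b * (c - d)) = c * (a * b) - d * (a * b) by intros; ring]
    refine (mul_le_mul_of_nonneg_right (norm_sub_le _ _) (by positivity)).trans_eq ?_
    rw [norm_mul (_ ^ 2) (_ * _), norm_mul ((t : ℂ) ^ 2)]; ring

/-- For fixed `n` the `q²`-binomial factor tends to `L · L⁻¹ · L⁻¹ = L⁻¹`, with `L = (q²; q²)_∞`,
and dominated convergence applies. It matters that `κ` does not depend on `t`: it cancels against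
the case `t = 0`. -/
theorem tendsto_finiteTheta_sum (hq : ‖q‖ < 1) :
    ∃ κ : ℂ, κ ≠ 0 ∧ ∀ t : ℕ,
      Tendsto (fun N => ∑' n : ℤ, finiteTheta q N n * chebCoeff t n) atTop
        (𝓝 (κ * ∑' n : ℤ, (-1) ^ n.natAbs * q ^ (n.natAbs ^ 2) * chebCoeff t n)) := by
  obtain ⟨L, hL0, hL⟩ := exists_tendsto_qPoch hq
  refine ⟨L⁻¹, inv_ne_zero hL0, fun t => ?_⟩
  obtain ⟨B, hB⟩ := hL.norm.bddAbove_range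
  have hLi := hL.inv₀ hL0
  obtain ⟨B', hB'⟩ := hLi.norm.bddAbove_range
  have hB1 : ∀ m, ‖qPoch q m‖ ≤ B := fun m => hB ⟨m, rfl⟩
  have hB'0 : 0 ≤ B' := (norm_nonneg _).trans (hB' ⟨0, rfl⟩)
  have hB2 : ∀ m, ‖qPochInv q m‖ ≤ B' := fun m => by
    rw [qPochInv]
    split_ifs
    · simpa using hB'0
    · exact hB' ⟨m.toNat, rfl⟩
  have hB0 : 0 ≤ B := (norm_nonneg _).trans (hB1 0)
  have hinv : ∀ n : ℤ, Tendsto (fun N : ℕ => qPochInv q (N + n)) atTop (𝓝 L⁻¹) := by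
    intro n
    have h1 : Tendsto (fun N : ℕ => ((N : ℤ) + n).toNat) atTop atTop := by
      refine tendsto_atTop.2 fun b => ?_
      filter_upwards [eventually_ge_atTop (b + n.natAbs)] with N hN
      omega
    refine (hLi.comp h1).congr' ?_
    filter_upwards [eventually_ge_atTop n.natAbs] with N hN
    rw [qPochInv, if_neg (by omega)]; rfl
  rw [← tsum_mul_left]
  refine tendsto_tsum_of_dominated_convergence (bound := fun n : ℤ =>
    (B * B' * B' * ‖(-1 : ℂ) ^ t / ((2 * t).factorial : ℂ)‖) *
      ‖(-1) ^ n.natAbs * sqFactorial t n * q ^ (n.natAbs ^ 2)‖)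
    (((discSummable_sqFactorial t).summable_norm hq).mul_left _) (fun n => ?_) ?_
  · have h2 : Tendsto (fun N : ℕ => 2 * N) atTop atTop :=
      tendsto_id.const_mul_atTop' two_pos
    have := ((((hL.comp h2).mul (hinv n)).mul (hinv (-n))).const_mul
      ((-1) ^ n.natAbs * q ^ (n.natAbs ^ 2))).mul_const (chebCoeff t n)
    rw [mul_inv_cancel₀ hL0, one_mul] at this
    rw [show L⁻¹ * ((-1) ^ n.natAbs * q ^ (n.natAbs ^ 2) * chebCoeff t n) =
      (-1) ^ n.natAbs * q ^ (n.natAbs ^ 2) * L⁻¹ * chebCoeff t n by ring]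
    exact this
  · refine Eventually.of_forall fun N n => ?_
    rw [show finiteTheta q N n * chebCoeff t n =
      (qPoch q (2 * N) * qPochInv q (N + n) * qPochInv q (N - n) *
        ((-1 : ℂ) ^ t / ((2 * t).factorial : ℂ))) *
        ((-1) ^ n.natAbs * sqFactorial t n * q ^ (n.natAbs ^ 2)) by
      rw [finiteTheta, chebCoeff]; ring, norm_mul]
    have key : ‖qPoch q (2 * N) * qPochInv q (N + n) * qPochInv q (N - n)‖ ≤ B * B' * B' := by
      rw [norm_mul, norm_mul]
      exact mul_le_mul (mul_le_mul (hB1 _) (hB2 _) (norm_nonneg _) hB0) (hB2 _) (norm_nonneg _)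
        (mul_nonneg hB0 hB'0)
    rw [norm_mul]
    exact mul_le_mul_of_nonneg_right (mul_le_mul_of_nonneg_right key (norm_nonneg _))
      (norm_nonneg _)

/-! ### MacMahon's series as a sum over finite sets, and its product with `θ₄`. -/

theorem summable_norm_pow_div_one_sub_sq (hq : ‖q‖ < 1) {e : ℕ → ℕ} (he : ∀ s, s ≤ e s) :
    Summable fun s => ‖q ^ e s / (1 - q ^ e s) ^ 2‖ := by
  have h1 : Tendsto (fun s : ℕ => q ^ e s) atTop (𝓝 0) :=
    (tendsto_pow_atTop_nhds_zero_of_norm_lt_one hq).comp (tendsto_atTop_mono he tendsto_id)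
  have h2 : Tendsto (fun s : ℕ => ‖((1 - q ^ e s) ^ 2)⁻¹‖) atTop (𝓝 1) := by
    have := (((tendsto_const_nhds (x := (1 : ℂ))).sub h1).pow 2).inv₀ (by simp)
    simpa using this.norm
  obtain ⟨B, hB⟩ := h2.bddAbove_range
  refine ((summable_geometric_of_lt_one (norm_nonneg q) hq).mul_left B).of_nonneg_of_le
    (fun _ => norm_nonneg _) fun s => ?_
  have hb := hB ⟨s, rfl⟩
  rw [div_eq_mul_inv, norm_mul, mul_comm]
  refine mul_le_mul hb ?_ (norm_nonneg _) ((norm_nonneg _).trans hb)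
  rw [norm_pow]
  exact pow_le_pow_of_le_one (norm_nonneg q) hq.le (he s)

theorem summable_norm_oddTerm (hq : ‖q‖ < 1) : Summable fun s => ‖oddTerm q s‖ :=
  summable_norm_pow_div_one_sub_sq hq fun s => by omega

theorem tendsto_partialEsymm {u : ℕ → ℂ} (hu : Summable fun s => ‖u s‖) (t : ℕ) :
    Tendsto (fun N => partialEsymm u N t) atTop
      (𝓝 (∑' s : Finset ℕ, if s.card = t then ∏ i ∈ s, u i else 0)) := by
  have hs : Summable fun s : Finset ℕ => if s.card = t then ∏ i ∈ s, u i else 0 := by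
    refine Summable.of_norm_bounded (summable_finsetProd_of_summable_norm hu).norm fun s => ?_
    split_ifs <;> simp [prod_nonneg]
  refine (hs.hasSum.comp (tendsto_finset_powerset_atTop_atTop.comp tendsto_finset_range)).congr
    fun N => ?_
  simp only [Function.comp_def]
  rw [partialEsymm, ← sum_filter, powersetCard_eq_filter]

/-- The underlying set of a strictly increasing family of positive integers, shifted to start
at `0`. -/
def predImage (t : ℕ) (s : Fin t ↪o ℕ+) : Finset ℕ :=
  univ.map (s.toEmbedding.trans ⟨PNat.natPred, PNat.natPred_injective⟩)

theorem predImage_injective (t : ℕ) : Function.Injective (predImage t) := by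
  intro s s' h
  have h1 : univ.map s.toEmbedding = univ.map s'.toEmbedding := by
    rw [predImage, predImage, ← Finset.map_map, ← Finset.map_map] at h
    exact Finset.map_injective _ h
  have h2 : Set.range s = Set.range s' := by
    have := congrArg (fun S : Finset ℕ+ => (S : Set ℕ+)) h1
    simpa using this
  exact DFunLike.coe_injective
    ((StrictMono.range_inj s.strictMono s'.strictMono).1 h2)

theorem exists_predImage_eq {t : ℕ} {S : Finset ℕ} (hS : S.card = t) : ∃ s, predImage t s = S := by
  let g : ℕ ↪o ℕ+ := OrderEmbedding.ofStrictMono Nat.succPNat Nat.succPNat_strictMono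
  refine ⟨(S.orderEmbOfFin hS).trans g, ?_⟩
  ext x
  rw [← S.mem_coe, ← S.range_orderEmbOfFin hS]
  simp [predImage, g, -range_orderEmbOfFin]

theorem term_eq_prod_predImage (t : ℕ) (q : ℂ) (s : Fin t ↪o ℕ+) :
    term t q s = ∏ i ∈ predImage t s, oddTerm q i := by
  rw [predImage, prod_map, term]
  refine prod_congr rfl fun i _ => ?_
  have h : 2 * (s i : ℕ) - 1 = 2 * (s i).natPred + 1 := by
    have := (s i).natPred_add_one; omega
  rw [h]; rfl

theorem card_predImage (t : ℕ) (s : Fin t ↪o ℕ+) : (predImage t s).card = t := by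
  simp [predImage]

theorem summable_term (t : ℕ) (hq : ‖q‖ < 1) : Summable (term t q) := by
  have := (summable_finsetProd_of_summable_norm (summable_norm_oddTerm hq)).comp_injective
    (predImage_injective t)
  exact this.congr fun s => (term_eq_prod_predImage t q s).symm

theorem C_eq_tsum (t : ℕ) (q : ℂ) :
    C t q = ∑' s : Finset ℕ, if s.card = t then ∏ i ∈ s, oddTerm q i else 0 := by
  rw [C, ← (predImage_injective t).tsum_eq]
  · refine tsum_congr fun s => ?_
    rw [if_pos (card_predImage t s), term_eq_prod_predImage]
  · intro S hS
    have : S.card = t := by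
      by_contra h
      exact hS (if_neg h)
    exact exists_predImage_eq this

theorem tsum_oddTerm_eq_C (hq : ‖q‖ < 1) : ∑' s, oddTerm q s = C 1 q := by
  have h1 := tendsto_partialEsymm (summable_norm_oddTerm hq) 1
  have h2 := (summable_norm_oddTerm hq).of_norm.hasSum.tendsto_sum_nat
  rw [C_eq_tsum]
  refine tendsto_nhds_unique h2 (h1.congr fun N => ?_)
  simp [partialEsymm, powersetCard_one]

/-- Let `N → ∞` in `partialEsymm_oddTerm`; its case `t = 0` shows that `∏ (1 - q^(2s+1))²` tends to
`κ θ₄`. The point `q = 0` is checked directly, because the finite recursion uses negative powers of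
`q`. -/
theorem C_mul_theta4_eq_tsum (t : ℕ) (hq : ‖q‖ < 1) :
    C t q * theta4 q = ∑' n : ℤ, (-1) ^ n.natAbs * q ^ (n.natAbs ^ 2) * chebCoeff t n := by
  by_cases h0 : q = 0
  · subst h0
    rw [tsum_eq_single 0 fun n hn => by simp [hn], theta4_zero, mul_one]
    rcases t with _ | t
    · rw [C_eq_tsum, tsum_eq_single ∅ fun S hS => if_neg (by simpa using hS)]
      simp [chebCoeff_zero]
    · have : term (t + 1) 0 = 0 := by
        ext s
        refine prod_eq_zero (mem_univ 0) ?_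
        have := (s 0).pos
        rw [zero_pow (by omega), zero_div]
      simp [C, this, chebCoeff_succ_zero]
  · obtain ⟨κ, hκ, h⟩ := tendsto_finiteTheta_sum hq
    simp only [← partialEsymm_oddTerm hq h0] at h
    have hE := tendsto_partialEsymm (summable_norm_oddTerm hq) t
    have hP := h 0
    simp only [partialEsymm_zero_right, chebCoeff_zero, one_mul, mul_one] at hP
    have := tendsto_nhds_unique (hE.mul hP) (h t)
    rw [← C_eq_tsum] at this
    refine mul_left_cancel₀ hκ ?_
    rw [← this, theta4]; ring

/-- Vieta's formula for `∏ (Y + j²)` evaluated at `Y = -x²`. -/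
theorem sqFactorial_eq_sum (t : ℕ) (x : ℂ) :
    (-1) ^ t * sqFactorial t x =
      ∑ k ∈ range (t + 1), (-1) ^ k * (esymmSquares t (t - k) : ℂ) * x ^ (2 * k) := by
  have h := Multiset.prod_X_add_C_eq_sum_esymm ((Multiset.range t).map fun i : ℕ => (i : ℂ) ^ 2)
  have h2 := congrArg (Polynomial.eval (-x ^ 2)) h
  rw [Polynomial.eval_multiset_prod, Polynomial.eval_finsetSum, Multiset.card_map,
    Multiset.card_range] at h2
  have h3 : (-1) ^ t * sqFactorial t x = ∏ j ∈ range t, (-x ^ 2 + (j : ℂ) ^ 2) := by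
    rw [sqFactorial, ← card_range t, ← prod_const, card_range, ← prod_mul_distrib]
    exact prod_congr rfl fun j _ => by ring
  have he : ∀ j, ((Multiset.range t).map fun i : ℕ => (i : ℂ) ^ 2).esymm j = esymmSquares t j := by
    intro j
    rw [esymmSquares, ← range_val, esymm_map_val, esymm_map_val]
    push_cast
    rfl
  rw [h3, ← sum_range_reflect]
  convert h2 using 1
  · simp [Multiset.map_map, Finset.prod]
  · refine sum_congr rfl fun k hk => ?_
    have hk' : k ≤ t := by simpa [Nat.lt_succ_iff] using hk
    rw [he, show t - (t + 1 - 1 - k) = k by omega, show t + 1 - 1 - k = t - k by omega]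
    simp only [Polynomial.eval_mul, Polynomial.eval_C, Polynomial.eval_pow, Polynomial.eval_X]
    rw [neg_pow (x ^ 2), ← pow_mul]; ring

/-! ### The Eisenstein series and the Ramanujan-type differential system. -/

/-- `∑ σ₁(n) qⁿ`. -/
def sigmaSeries (q : ℂ) : ℂ :=
  ∑' n : ℕ+, (ArithmeticFunction.sigma 1 (n : ℕ) : ℂ) * q ^ (n : ℕ)

theorem eisenstein_one (q : ℂ) : eisenstein 1 q = 1 - 24 * sigmaSeries q := by
  rw [eisenstein, sigmaSeries, mul_one, bernoulli_two]
  norm_num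

theorem sigmaSeries_eq_tsum (hq : ‖q‖ < 1) :
    sigmaSeries q = ∑' n : ℕ, q ^ (n + 1) / (1 - q ^ (n + 1)) ^ 2 := by
  rw [sigmaSeries, ← tsum_prod_pow_eq_tsum_sigma 1 hq,
    tsum_pnat_eq_tsum_succ (f := fun d => ∑' c : ℕ+, (c : ℂ) ^ 1 * q ^ (d * c : ℕ))]
  refine tsum_congr fun d => ?_
  have hd : ‖q ^ (d + 1)‖ < 1 := by
    rw [norm_pow]; exact pow_lt_one₀ (norm_nonneg q) hq d.succ_ne_zero
  rw [← tsum_coe_mul_geometric_of_norm_lt_one hd,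
    tsum_pnat_eq_tsum_succ (f := fun c => (c : ℂ) ^ 1 * q ^ ((d + 1) * c : ℕ))]
  have hs : Summable fun c : ℕ => (c : ℂ) * (q ^ (d + 1)) ^ c := by
    simpa using summable_pow_mul_geometric_of_norm_lt_one 1 hd
  rw [hs.tsum_eq_zero_add]
  simp [pow_mul]

theorem sigmaSeries_sub_sq (hq : ‖q‖ < 1) :
    sigmaSeries q - sigmaSeries (q ^ 2) = ∑' s, oddTerm q s := by
  have ho := (summable_norm_oddTerm hq).of_norm
  have he := (summable_norm_pow_div_one_sub_sq hq (e := fun s => 2 * s + 1 + 1)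
    fun s => by omega).of_norm
  have h := tsum_even_add_odd (f := fun n => q ^ (n + 1) / (1 - q ^ (n + 1)) ^ 2) ho he
  rw [sigmaSeries_eq_tsum hq, sigmaSeries_eq_tsum (norm_sq_lt_one hq), ← h, sub_eq_iff_eq_add]
  congr 1
  refine tsum_congr fun k => ?_
  rw [← pow_mul]; rfl

theorem discSummable_sigma : DiscSummable
    (fun n : ℕ+ => (ArithmeticFunction.sigma 1 (n : ℕ) : ℂ)) fun n => (n : ℕ) := by
  intro r h0 h1
  have := (summable_pow_mul_geometric_of_norm_lt_one 2 (r := r)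
    (by rwa [Real.norm_of_nonneg h0])).comp_injective PNat.coe_injective
  refine this.of_nonneg_of_le (fun n => by positivity) fun n => ?_
  simp only [Complex.norm_natCast, Function.comp_apply]
  refine mul_le_mul_of_nonneg_right ?_ (pow_nonneg h0 _)
  exact_mod_cast ArithmeticFunction.sigma_le_pow_succ 1 (n : ℕ)

theorem chebCoeff_one (x : ℂ) : chebCoeff 1 x = -(1 / 2) * x ^ 2 := by
  simp [chebCoeff, sqFactorial]; ring

/-- The case `t = 1` of `C_mul_theta4_eq_tsum`, combined with the Lambert series: removing the even
indices from `∑ qⁿ/(1 - qⁿ)²` leaves MacMahon's series for `t = 1`. -/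
theorem logD4_eq (hq : ‖q‖ < 1) : logD4 q = -2 * (sigmaSeries q - sigmaSeries (q ^ 2)) := by
  have h := C_mul_theta4_eq_tsum 1 hq
  have h2 : ∑' n : ℤ, (-1) ^ n.natAbs * q ^ (n.natAbs ^ 2) * chebCoeff 1 n =
      -(1 / 2) * qD theta4 q := by
    rw [← theta4Moment_zero, qD_theta4Moment 0 hq, theta4Moment, ← tsum_mul_left]
    refine tsum_congr fun n => ?_
    rw [chebCoeff_one]; ring
  rw [sigmaSeries_sub_sq hq, tsum_oddTerm_eq_C hq, logD4, div_eq_iff (theta4_ne_zero hq), mul_assoc,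
    h, h2]
  ring

theorem theta2Four_sq (q : ℂ) : theta2Four (q ^ 2) = (q * psi (q ^ 2) ^ 2) ^ 2 := by
  rw [theta2Four]; ring

theorem theta3Four_sq (q : ℂ) : theta3Four (q ^ 2) = (theta3' (q ^ 2) ^ 2) ^ 2 := by
  rw [theta3Four]; ring

theorem eisenstein_eq (hq : ‖q‖ < 1) :
    eisenstein 1 q = 24 * logD4 q + theta2Four q + theta3Four q := by
  have hc : ContinuousAt (fun q => theta2Four q + theta3Four q - (1 - 24 * sigmaSeries q) +
      24 * logD4 q) 0 := by
    have hs : ContinuousAt sigmaSeries 0 :=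
      continuousAt_zero_of_differentiableOn discSummable_sigma.differentiableOn
    have h2 := continuousAt_zero_of_differentiableOn differentiableOn_theta2Four
    have h3 := continuousAt_zero_of_differentiableOn differentiableOn_theta3Four
    have h4 := continuousAt_zero_of_differentiableOn differentiableOn_logD4
    fun_prop
  -- The difference of the two sides is invariant under `q ↦ q²` and vanishes at `0`, where `θ₃⁴ =
  -- 1`.
  have h := eq_apply_zero_of_sq_invariant hc (fun w hw => ?_) hq
  · have hs0 : sigmaSeries 0 = 0 := by
      rw [sigmaSeries_eq_tsum (by simp)]; simp
    simp only [logD4_zero, hs0, theta2Four, theta3Four, theta3'_zero] at h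
    rw [eisenstein_one, theta2Four, theta3Four]
    linear_combination -h
  · have h1 := theta2Four_duplication hw
    have h2 := theta3Four_duplication hw
    have h3 := two_mul_logD4_sq hw
    have h4 := logD4_eq hw
    rw [theta2Four_sq, theta3Four_sq]
    linear_combination (-1 / 2 : ℂ) * h1 + h2 + 12 * h4 - 12 * h3

theorem hasQD_eisenstein (hq : ‖q‖ < 1) : HasQD (eisenstein 1)
    ((eisenstein 1 q ^ 2 - theta2Four q ^ 2 - 14 * (theta2Four q * theta3Four q) -
      theta3Four q ^ 2) / 12) q := by
  have h4 := (HasQD.of_differentiableOn differentiableOn_logD4 hq).congr_eq (qD_logD4 hq)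
  refine ((((h4.const_mul 24).add (hasQD_theta2Four hq)).add (hasQD_theta3Four hq)).congr_disc hq
    fun w hw => eisenstein_eq hw).congr_eq ?_
  have h2 := logD2_sub_logD4 hq
  have h3 := logD3_sub_logD4 hq
  rw [eisenstein_eq hq]
  linear_combination 4 * theta2Four q * h2 + 4 * theta3Four q * h3

/-- The logarithmic derivative of `θ₂⁴`. -/
theorem four_mul_logD2 (hq : ‖q‖ < 1) :
    4 * logD2 q = (eisenstein 1 q + 5 * theta3Four q - theta2Four q) / 6 := by
  rw [eisenstein_eq hq]; linear_combination 4 * logD2_sub_logD4 hq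

/-- The logarithmic derivative of `θ₃⁴`. -/
theorem four_mul_logD3 (hq : ‖q‖ < 1) :
    4 * logD3 q = (eisenstein 1 q + 5 * theta2Four q - theta3Four q) / 6 := by
  rw [eisenstein_eq hq]; linear_combination 4 * logD3_sub_logD4 hq

theorem HasQD.pow_log {f : ℂ → ℂ} {l q : ℂ} (h : HasQD f (l * f q) q) (n : ℕ) :
    HasQD (fun q => f q ^ n) (n * l * f q ^ n) q := by
  refine (h.pow n).congr_eq ?_
  rcases n with _ | n
  · simp
  · rw [Nat.add_sub_cancel, pow_succ]; ring

/-! ### The coefficients `cc` and the derivation they encode. -/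

theorem cc_eq_zero {α β γ : ℤ} (h : α < 0 ∨ β < 0 ∨ γ < 0) : cc α β γ = 0 := by
  rw [cc, if_pos h]

theorem cc_zero : cc 0 0 0 = 1 := by
  rw [cc]; simp

/-- The recursion for `cc`, valid at every triple of integers other than the origin. -/
theorem cc_rec (α β γ : ℤ) (h : ¬ (α = 0 ∧ β = 0 ∧ γ = 0)) :
    cc α β γ = (2 * α + 4 * β + 4 * γ - 1) / 24 * cc (α - 1) β γ
      + (20 * γ - 4 * β + 3) / 24 * cc α (β - 1) γ
      + (20 * β - 4 * γ + 3) / 24 * cc α β (γ - 1)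
      - 7 * (α + 1) / 6 * cc (α + 1) (β - 1) (γ - 1)
      - (α + 1) / 12 * cc (α + 1) (β - 2) γ
      - (α + 1) / 12 * cc (α + 1) β (γ - 2) := by
  by_cases h1 : α < 0 ∨ β < 0 ∨ γ < 0
  · rw [cc_eq_zero h1, cc_eq_zero (α := α - 1) (by omega), cc_eq_zero (β := β - 1) (by omega),
      cc_eq_zero (α := α) (γ := γ - 1) (by omega)]
    -- Only at `α = -1` can the terms with `α + 1` be nonzero values of `cc`, and there the factor
    -- `α + 1` kills them.
    by_cases h2 : α = -1
    · subst h2; norm_num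
    · rw [cc_eq_zero (α := α + 1) (β := β - 1) (by omega), cc_eq_zero (α := α + 1) (β := β - 2) (by omega),
        cc_eq_zero (α := α + 1) (γ := γ - 2) (by omega)]
      ring
  · rw [cc, if_neg h1, if_neg h]

theorem cc_comm (α β γ : ℤ) : cc α β γ = cc α γ β := by
  induction h : (α + β + γ).toNat using Nat.strong_induction_on generalizing α β γ with
  | _ n ih =>
    by_cases h1 : α < 0 ∨ β < 0 ∨ γ < 0
    · rw [cc_eq_zero h1, cc_eq_zero (by tauto)]
    by_cases h2 : α = 0 ∧ β = 0 ∧ γ = 0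
    · rw [h2.2.1, h2.2.2]
    rw [cc_rec α β γ h2, cc_rec α γ β (by tauto),
      ih _ (by omega) (α - 1) β γ rfl, ih _ (by omega) α (β - 1) γ rfl,
      ih _ (by omega) α β (γ - 1) rfl, ih _ (by omega) (α + 1) (β - 1) (γ - 1) rfl,
      ih _ (by omega) (α + 1) (β - 2) γ rfl, ih _ (by omega) (α + 1) β (γ - 2) rfl]
    ring

/-- The part of the coefficient family `cc` of total degree `k`. -/
def ccDegree (k : ℕ) (x : ℤ × ℤ × ℤ) : ℂ :=
  if x.1 + x.2.1 + x.2.2 = k then (cc x.1 x.2.1 x.2.2 : ℂ) else 0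

/-- A finite set containing the support of `ccDegree k`. -/
def degreeSimplex (k : ℕ) : Finset (ℤ × ℤ × ℤ) :=
  {x ∈ Icc (0 : ℤ) k ×ˢ Icc (0 : ℤ) k ×ˢ Icc (0 : ℤ) k | x.1 + x.2.1 + x.2.2 = k}

theorem mem_degreeSimplex {k : ℕ} {x : ℤ × ℤ × ℤ} : x ∈ degreeSimplex k ↔
    0 ≤ x.1 ∧ 0 ≤ x.2.1 ∧ 0 ≤ x.2.2 ∧ x.1 + x.2.1 + x.2.2 = k := by
  simp only [degreeSimplex, mem_filter, mem_product, mem_Icc]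
  constructor
  · tauto
  · intro h; refine ⟨⟨?_, ?_, ?_⟩, ?_⟩ <;> omega

theorem ccDegree_eq_zero {k : ℕ} {x : ℤ × ℤ × ℤ} (h : x ∉ degreeSimplex k) : ccDegree k x = 0 := by
  rw [ccDegree]
  split_ifs with h1
  · rw [cc_eq_zero, Rat.cast_zero]
    by_contra! h2
    exact h (mem_degreeSimplex.2 ⟨h2.1, h2.2.1, h2.2.2, h1⟩)
  · rfl

theorem summable_ccDegree_mul (k : ℕ) (g : ℤ × ℤ × ℤ → ℂ) :
    Summable fun x => ccDegree k x * g x :=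
  summable_of_ne_finset_zero (s := degreeSimplex k) fun x hx => by
    rw [ccDegree_eq_zero hx, zero_mul]

theorem tsum_ccDegree_mul (k : ℕ) (g : ℤ × ℤ × ℤ → ℂ) :
    ∑' x, ccDegree k x * g x = ∑ x ∈ degreeSimplex k, ccDegree k x * g x :=
  tsum_eq_sum fun x hx => by rw [ccDegree_eq_zero hx, zero_mul]

/-- Translation is a bijection of `ℤ³`, so the shifts in the recursion move onto the monomials
without boundary terms. -/
theorem hasSum_ccDegree_shift (k : ℕ) (v : ℤ × ℤ × ℤ) (g : ℤ × ℤ × ℤ → ℂ) :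
    HasSum (fun x => ccDegree k (x - v) * g x) (∑' x, ccDegree k x * g (x + v)) := by
  rw [← (Equiv.addRight v).hasSum_iff]
  simpa [Function.comp_def] using (summable_ccDegree_mul k fun x => g (x + v)).hasSum

theorem ccDegree_succ (k : ℕ) (x : ℤ × ℤ × ℤ) : ccDegree (k + 1) x =
    ccDegree k (x - (1, 0, 0)) * ((2 * x.1 + 4 * x.2.1 + 4 * x.2.2 - 1) / 24)
      + ccDegree k (x - (0, 1, 0)) * ((20 * x.2.2 - 4 * x.2.1 + 3) / 24)
      + ccDegree k (x - (0, 0, 1)) * ((20 * x.2.1 - 4 * x.2.2 + 3) / 24)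
      - ccDegree k (x - (-1, 1, 1)) * (7 * (x.1 + 1) / 6)
      - ccDegree k (x - (-1, 2, 0)) * ((x.1 + 1) / 12)
      - ccDegree k (x - (-1, 0, 2)) * ((x.1 + 1) / 12) := by
  obtain ⟨α, β, γ⟩ := x
  simp only [ccDegree, Prod.mk_sub_mk, sub_zero, sub_neg_eq_add]
  by_cases h : α + β + γ = ((k + 1 : ℕ) : ℤ)
  · have h' : α + β + γ = (k : ℤ) + 1 := by exact_mod_cast h
    rw [if_pos h, if_pos (by omega), if_pos (by omega), if_pos (by omega), if_pos (by omega),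
      if_pos (by omega), if_pos (by omega), cc_rec α β γ (by omega)]
    push_cast; ring
  · have h' : ¬ α + β + γ = (k : ℤ) + 1 := by exact_mod_cast h
    rw [if_neg h, if_neg (by omega), if_neg (by omega), if_neg (by omega), if_neg (by omega),
      if_neg (by omega), if_neg (by omega)]
    ring

/-- The monomial `P^α a^β b^γ`. -/
def monom3 (P a b : ℂ) (x : ℤ × ℤ × ℤ) : ℂ := P ^ x.1.toNat * a ^ x.2.1.toNat * b ^ x.2.2.toNat

/-- The value on `P^α a^β b^γ` of the derivation sending `P`, `a`, `b` to
`(P² - a² - 14ab - b²)/12`, `a(P + 5b - a)/6`, `b(P + 5a - b)/6`. -/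
def monom3Deriv (P a b : ℂ) (x : ℤ × ℤ × ℤ) : ℂ :=
  (x.1.toNat * P ^ (x.1.toNat - 1) * ((P ^ 2 - a ^ 2 - 14 * (a * b) - b ^ 2) / 12)) *
      (a ^ x.2.1.toNat * b ^ x.2.2.toNat) +
    (x.2.1.toNat * ((P + 5 * b - a) / 6) + x.2.2.toNat * ((P + 5 * a - b) / 6)) * monom3 P a b x

/-- The recursion for `cc` is the operator `D + (P - a - b)/24` written on coefficients: each of its
six terms corresponds to multiplying a monomial by `P`, `a`, `b`, `ab/P`, `a²/P` or `b²/P`. -/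
theorem tsum_ccDegree_succ (k : ℕ) (P a b : ℂ) :
    ∑' x, ccDegree (k + 1) x * monom3 P a b x =
      ∑' x, ccDegree k x * (monom3Deriv P a b x + (P - a - b) / 24 * monom3 P a b x) := by
  have h1 := hasSum_ccDegree_shift k (1, 0, 0) fun x =>
    ((2 * x.1 + 4 * x.2.1 + 4 * x.2.2 - 1) / 24) * monom3 P a b x
  have h2 := hasSum_ccDegree_shift k (0, 1, 0) fun x =>
    ((20 * x.2.2 - 4 * x.2.1 + 3) / 24) * monom3 P a b x
  have h3 := hasSum_ccDegree_shift k (0, 0, 1) fun x =>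
    ((20 * x.2.1 - 4 * x.2.2 + 3) / 24) * monom3 P a b x
  have h4 := hasSum_ccDegree_shift k (-1, 1, 1) fun x => (7 * (x.1 + 1) / 6) * monom3 P a b x
  have h5 := hasSum_ccDegree_shift k (-1, 2, 0) fun x => ((x.1 + 1) / 12) * monom3 P a b x
  have h6 := hasSum_ccDegree_shift k (-1, 0, 2) fun x => ((x.1 + 1) / 12) * monom3 P a b x
  refine ((tsum_congr fun x => ?_).trans
    (((((h1.add h2).add h3).sub h4).sub h5).sub h6).tsum_eq).trans ?_
  · rw [ccDegree_succ]; ring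
  · have s := fun g => (summable_ccDegree_mul k g).hasSum
    refine (((((((s _).add (s _)).add (s _)).sub (s _)).sub (s _)).sub (s _)).tsum_eq).symm.trans
      (tsum_congr fun x => ?_)
    by_cases hx : x ∈ degreeSimplex k
    · obtain ⟨α, β, γ⟩ := x
      obtain ⟨hα, hβ, hγ, -⟩ := mem_degreeSimplex.1 hx
      lift α to ℕ using hα
      lift β to ℕ using hβ
      lift γ to ℕ using hγ
      have e1 : ∀ n : ℕ, ((n : ℤ) + 1).toNat = n + 1 := fun n => by omega
      have e2 : ∀ n : ℕ, ((n : ℤ) + 2).toNat = n + 2 := fun n => by omega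
      have e3 : ∀ n : ℕ, ((n : ℤ) + -1).toNat = n - 1 := fun n => by omega
      simp only [monom3, monom3Deriv, Prod.mk_add_mk, e1, e2, e3, add_zero, Int.toNat_natCast]
      -- At `α = 0` the truncated exponent `α - 1` is harmless: after the shift its coefficient is a
      -- multiple of `α`.
      rcases α with _ | α
      · push_cast; ring
      · simp only [Nat.add_sub_cancel]
        push_cast; ring
    · rw [ccDegree_eq_zero hx]; ring

/-- `∑ c_c(α, β, γ) P^α a^β b^γ` over all triples of degree `k`. -/
def degreeSum (k : ℕ) (P a b : ℂ) : ℂ := ∑ x ∈ degreeSimplex k, ccDegree k x * monom3 P a b x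

theorem degreeSum_zero (P a b : ℂ) : degreeSum 0 P a b = 1 := by
  rw [degreeSum, sum_eq_single (0, 0, 0)]
  · simp [ccDegree, monom3, cc_zero]
  · rintro ⟨α, β, γ⟩ hx hne
    obtain ⟨h1, h2, h3, h4⟩ := mem_degreeSimplex.1 hx
    simp only [Nat.cast_zero] at h1 h2 h3 h4
    refine absurd ?_ hne
    simp only [Prod.mk.injEq]; omega
  · intro h; exact absurd (mem_degreeSimplex.2 (by simp)) h

theorem degreeSum_succ (k : ℕ) (P a b : ℂ) : degreeSum (k + 1) P a b =
    (∑ x ∈ degreeSimplex k, ccDegree k x * monom3Deriv P a b x) +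
      (P - a - b) / 24 * degreeSum k P a b := by
  rw [degreeSum, ← tsum_ccDegree_mul, tsum_ccDegree_succ, tsum_ccDegree_mul, degreeSum, mul_sum,
    ← sum_add_distrib]
  exact sum_congr rfl fun x _ => by ring

theorem hasQD_degreeSum (k : ℕ) (hq : ‖q‖ < 1) :
    HasQD (fun q => degreeSum k (eisenstein 1 q) (theta2Four q) (theta3Four q))
      (∑ x ∈ degreeSimplex k,
        ccDegree k x * monom3Deriv (eisenstein 1 q) (theta2Four q) (theta3Four q) x) q := by
  refine HasQD.sum fun x _ => HasQD.const_mul _ ?_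
  have ha := ((hasQD_theta2Four hq).pow_log x.2.1.toNat)
  have hb := ((hasQD_theta3Four hq).pow_log x.2.2.toNat)
  refine ((((hasQD_eisenstein hq).pow x.1.toNat).mul ha).mul hb).congr_eq ?_
  rw [four_mul_logD2 hq, four_mul_logD3 hq, monom3Deriv, monom3]; ring

/-! ### Derivatives of `θ₄` in terms of `E₂`, `θ₂⁴`, `θ₃⁴`, and conclusion. -/

theorem theta4Moment_eq (k : ℕ) : ∀ {q : ℂ}, ‖q‖ < 1 → theta4Moment k q =
    theta4 q * degreeSum k (eisenstein 1 q) (theta2Four q) (theta3Four q) := by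
  induction k with
  | zero => intro q _; rw [degreeSum_zero, theta4Moment_zero, mul_one]
  | succ k ih =>
    intro q hq
    rw [← qD_theta4Moment k hq, degreeSum_succ]
    refine (((hasQD_theta4 hq).mul (hasQD_degreeSum k hq)).congr_disc hq
      fun w hw => ih hw).qD_eq.trans ?_
    rw [eisenstein_eq hq]; ring

theorem sum_antidiagonal_cc (k : ℕ) (P a b : ℂ) :
    ∑ x ∈ antidiagonal k, ∑ y ∈ antidiagonal x.2,
      (cc x.1 y.1 y.2 : ℂ) * P ^ x.1 * (a ^ y.1 * b ^ y.2) = degreeSum k P a b := by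
  rw [sum_sigma', degreeSum]
  refine sum_bij' (fun z _ => ((z.1.1 : ℤ), (z.2.1 : ℤ), (z.2.2 : ℤ)))
    (fun x _ => ⟨(x.1.toNat, (x.2.1 + x.2.2).toNat), (x.2.1.toNat, x.2.2.toNat)⟩) ?_ ?_ ?_ ?_ ?_
  · rintro ⟨⟨i, j⟩, ⟨m, n⟩⟩ h
    simp only [mem_sigma, HasAntidiagonal.mem_antidiagonal] at h
    rw [mem_degreeSimplex]; simp only; omega
  · rintro ⟨α, β, γ⟩ h
    have := mem_degreeSimplex.1 h
    simp only [mem_sigma, HasAntidiagonal.mem_antidiagonal] at this ⊢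
    omega
  · rintro ⟨⟨i, j⟩, ⟨m, n⟩⟩ h
    simp only [mem_sigma, HasAntidiagonal.mem_antidiagonal] at h
    have : ((m : ℤ) + n).toNat = j := by omega
    simp [this]
  · rintro ⟨α, β, γ⟩ h
    have := mem_degreeSimplex.1 h
    simp only [Prod.mk.injEq] at this ⊢
    omega
  · rintro ⟨⟨i, j⟩, ⟨m, n⟩⟩ h
    simp only [mem_sigma, HasAntidiagonal.mem_antidiagonal] at h
    rw [ccDegree, if_pos (by simp only; omega)]
    simp [monom3, mul_assoc]

theorem expansion_eq (k : ℕ) (q : ℂ) :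
    expansion k q = 2 * degreeSum k (eisenstein 1 q) (theta2Four q) (theta3Four q) := by
  have h2 : ∀ n, theta2 q ^ (4 * n) = theta2Four q ^ n := fun n => by
    rw [pow_mul, theta2_pow_four]; rfl
  have h3 : ∀ n, theta3 q ^ (4 * n) = theta3Four q ^ n := fun n => by
    rw [pow_mul, theta3_eq]; rfl
  rw [two_mul]
  conv_rhs => rw [← sum_antidiagonal_cc]
  rw [expansion, ← sum_add_distrib]
  refine sum_congr rfl fun x _ => ?_
  -- By the symmetry `cc_comm`, both halves of `Θ_{β,γ}` contribute the same sum, whence the factor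
  -- `2`.
  have hswap : ∑ y ∈ antidiagonal x.2, (cc x.1 y.1 y.2 : ℂ) * eisenstein 1 q ^ x.1 *
      (theta2Four q ^ y.2 * theta3Four q ^ y.1) = ∑ y ∈ antidiagonal x.2,
      (cc x.1 y.1 y.2 : ℂ) * eisenstein 1 q ^ x.1 * (theta2Four q ^ y.1 * theta3Four q ^ y.2) := by
    rw [← Nat.sum_antidiagonal_swap]
    refine sum_congr rfl fun y _ => ?_
    simp only [Prod.fst_swap, Prod.snd_swap]
    rw [cc_comm]
  conv_rhs =>
    congr
    · skip
    · rw [← hswap]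
  rw [← sum_add_distrib]
  refine sum_congr rfl fun y _ => ?_
  rw [Theta, h2, h3, h2, h3]; ring

theorem C_mul_theta4 (t : ℕ) (hq : ‖q‖ < 1) : C t q * theta4 q =
    ∑ k ∈ range (t + 1), (-1) ^ k * ((esymmSquares t (t - k) : ℂ) / ((2 * t).factorial : ℂ)) *
      theta4Moment k q := by
  rw [C_mul_theta4_eq_tsum t hq]
  have h := hasSum_sum fun k (_ : k ∈ range (t + 1)) =>
    ((discSummable_theta4Moment k).summable hq).hasSum.mul_left
      ((-1) ^ k * ((esymmSquares t (t - k) : ℂ) / ((2 * t).factorial : ℂ)))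
  refine (tsum_congr fun n => ?_).trans h.tsum_eq
  rw [chebCoeff, div_mul_eq_mul_div, sqFactorial_eq_sum, sum_div, mul_sum]
  exact sum_congr rfl fun k _ => by ring

/-- The only product of `t` of the squares contains `0²`. This removes the `k = 0` term, so the
final sum starts at `k = 1`. -/
theorem esymmSquares_self {t : ℕ} (ht : 1 ≤ t) : esymmSquares t t = 0 := by
  rw [esymmSquares, ← range_val, esymm_map_val]
  refine sum_eq_zero fun s hs => ?_
  have hs' : s = range t := by
    have := mem_powersetCard.1 hs
    exact eq_of_subset_of_card_le this.1 (by rw [card_range, this.2])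
  rw [hs']
  exact prod_eq_zero (mem_range.2 ht) (by simp)

end

end MacMahonC


theorem theorem1p4 (t : ℕ) (ht : 1 ≤ t) (q : ℂ) (hq : ‖q‖ < 1) :
    Summable (MacMahonC.term t q) ∧
    MacMahonC.C t q =
      ∑ k ∈ Finset.Icc 1 t,
        (-1 : ℂ) ^ k * ((MacMahonC.esymmSquares t (t - k) : ℂ) / ((2 * t).factorial : ℂ)) *
          ((1 / 2) * MacMahonC.expansion k q) := by
  refine ⟨MacMahonC.summable_term t hq, ?_⟩
  refine mul_right_cancel₀ (MacMahonC.theta4_ne_zero hq) ?_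
  rw [MacMahonC.C_mul_theta4 t hq, Finset.sum_range_succ', Nat.sub_zero,
    MacMahonC.esymmSquares_self ht, Finset.sum_mul, Finset.range_eq_Ico,
    Finset.sum_Ico_add' (fun k => (-1 : ℂ) ^ k * ((MacMahonC.esymmSquares t (t - k) : ℂ) /
      ((2 * t).factorial : ℂ)) * MacMahonC.theta4Moment k q)]
  simp only [Nat.cast_zero, zero_div, mul_zero, zero_mul, add_zero, zero_add]
  refine Finset.sum_congr rfl fun k _ => ?_
  rw [MacMahonC.theta4Moment_eq k hq, MacMahonC.expansion_eq]
  ring
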